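/- Consider $m$ bosonic modes, with Hilbert space $L^2(\mathbb R^m)$, and let $\Omega$ be the canonical symplectic form on $\mathbb R^{2m}$, $\mathrm{Sp}_{2m}(\mathbb R)=\{S: S^\top\Omega S=\Omega\}$, and $\|\cdot\|_\infty$ the spectral (operator) norm. Let $D_{\mathbf r}=e^{-i\mathbf r^\top\Omega\hat{\mathbf R}}$ be the displacement operators and let $|\mathbf m\rangle=D_{\mathbf m}|0\rangle$ be the coherent state with first moment $\mathbf m\in\mathbb R^{2m}$. Let $G=D_{\mathbf r}U_S$ be an unknown Gaussian unitary, where $\mathbf r\in\mathbb R^{2m}$, $S\in\mathrm{Sp}_{2m}(\mathbb R)$ with $\|S\|_\infty\le z$, and $U_S$ is a unitary with $U_SD_{\mathbf s}U_S^\dagger=D_{S\mathbf s}$ for all $\mathbf s$. Heterodyne detection of a pure state $\psi$ has outcome density $(2\pi)^{-m}|\langle \xi|\psi\rangle|^2$ in $\xi\in\mathbb R^{2m}$, where $|\xi\rangle$ is the coherent state with first moment $\xi$ (for a Gaussian state with mean $\mu$ and covariance matrix $V$, normalised to $V=\mathbb 1$ for the vacuum, this is $\mathcal N(\mu,(V+\mathbb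 1)/2)$). Fix $\eta>0$, $\tau\in(0,1)$, $\delta\in(0,1)$ and $N_S\in\mathbb N$, and let $e_1,\dots,e_{2m}$ be the standard basis of $\mathbb R^{2m}$. All shots below are independent; each uses $G$ once and ends with heterodyne detection. *Vacuum-shared estimate.* Measure $N_S$ copies of $G|0\rangle$ and, for each $i\in\{1,\dots,2m\}$, $N_S$ copies of $G|\eta e_i\rangle$; let $\bar Y_0,\bar Y_i$ be the empirical means and let $\hat S$ have columns $\hat S_i=(\bar Y_i-\bar Y_0)/\eta$. *Symmetric-probe estimate.* For each $i\in\{1,\dots,2m\}$ measure $N_S$ copies of $G|\eta e_i\rangle$ and $N_S$ copies of $G|-\eta e_i\rangle$; let $\bar Y_i^{(\pm)}$ be the empirical means and let $\hat S$ have columns $\hat S_i=(\bar Y_i^{(+)}-\bar Y_i^{(-)})/(2\eta)$. *Symplectic regularization.* Given $\hat S$, put $T=-\Omega\hat S^\top\Omega\hat S$, let $Q=\sqrt T$ be the principal square root (the unique real square root all of whose eigenvalues have positive real part; the regularization is defined when it exists), and set $\tilde S=\hat S\,Q^{-1}$. Then: 1. Whenever the regularization of a matrix $\hat S$ is defined,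 $\tilde S\in\mathrm{Sp}_{2m}(\mathbb R)$. 2. The vacuum-shared scheme uses $G$ exactly $(2m+1)N_S$ times, and if $$N_S\ \ge\ \frac{324\,m\,z^6\bigl(\sqrt{2m}+\sqrt{2\log(2m/\delta)}\bigr)^2}{\eta^2\tau^2},$$ then with probability at least $1-\delta$ the regularization $\tilde S$ of its estimate $\hat S$ is defined, is exactly symplectic, and satisfies $\|\tilde S-S\|_\infty\le\tau$. 3. The symmetric-probe scheme uses $G$ exactly $4mN_S$ times, and if $$N_S\ \ge\ \frac{81\,z^6\bigl(2\sqrt{2m}+\sqrt{2\log(1/\delta)}\bigr)^2}{2\eta^2\tau^2},$$ then with probability at least $1-\delta$ the regularization $\tilde S$ of its estimate $\hat S$ is defined, is exactly symplectic, and satisfies $\|\tilde S-S\|_\infty\le\tau$. -/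

import Mathlib

open MeasureTheory
open scoped Matrix Matrix.Norms.L2Operator

noncomputable section

/-! # The `m`-mode system, displacements, coherent states and Gaussian unitaries -/

/-- Index set of the `2m` quadratures: `Sum.inl j` is the position `x_j` and `Sum.inr j` the
momentum `p_j` of mode `j`. -/
abbrev Quad (m : ℕ) : Type := Fin m ⊕ Fin m

/-- Phase space `ℝ^{2m}` with its Euclidean structure. -/
abbrev PhaseSpace (m : ℕ) : Type := EuclideanSpace ℝ (Quad m)

/-- Configuration space `ℝ^m`. -/
abbrev ConfigSpace (m : ℕ) : Type := EuclideanSpace ℝ (Fin m)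

/-- Real `2m × 2m` matrices. In the statements below their norm is the `ℓ²` operator norm. -/
abbrev QuadMatrix (m : ℕ) : Type := Matrix (Quad m) (Quad m) ℝ

/-- The Hilbert space `L²(ℝ^m)` of `m` bosonic modes. -/
abbrev ModeSpace (m : ℕ) : Type := Lp ℂ 2 (volume : Measure (ConfigSpace m))

/-- The canonical symplectic form: `Ω` pairs `x_j` with `p_j` through the block
`(0, 1; -1, 0)`. -/
def omegaForm (m : ℕ) : QuadMatrix m := -Matrix.J (Fin m) ℝ

/-- The position part of a phase-space vector. -/
def positionPart {m : ℕ} (r : PhaseSpace m) : ConfigSpace m := WithLp.toLp 2 fun j => r (Sum.inl j)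

/-- The momentum part of a phase-space vector. -/
def momentumPart {m : ℕ} (r : PhaseSpace m) : ConfigSpace m := WithLp.toLp 2 fun j => r (Sum.inr j)

/-- The wave function `x ↦ exp(i(⟪p, x⟫ - ⟪p, q⟫ / 2)) ψ(x - q)`, where `r = (q, p)`. -/
def displacedWave {m : ℕ} (r : PhaseSpace m) (ψ : ConfigSpace m → ℂ) (x : ConfigSpace m) : ℂ :=
  Complex.exp (Complex.I *
      ((inner ℝ (momentumPart r) x - inner ℝ (momentumPart r) (positionPart r) / 2 : ℝ) : ℂ)) *
    ψ (x - positionPart r)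

theorem memLp_displacedWave {m : ℕ} (r : PhaseSpace m) (ψ : ModeSpace m) :
    MemLp (displacedWave r ψ) 2 (volume : Measure (ConfigSpace m)) := by
  have h : MemLp (fun x => ψ (x - positionPart r)) 2 (volume : Measure (ConfigSpace m)) :=
    (Lp.memLp ψ).comp_measurePreserving (measurePreserving_sub_right volume (positionPart r))
  refine h.congr_norm ?_ ?_
  · refine AEStronglyMeasurable.mul (Continuous.aestronglyMeasurable ?_) h.1
    fun_prop
  · refine Filter.Eventually.of_forall fun x => ?_
    simp only [displacedWave, norm_mul]
    rw [mul_comm Complex.I, Complex.norm_exp_ofReal_mul_I, one_mul]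

/-- The displacement (Weyl) operator `D_r = exp(-i rᵀ Ω R̂)`: for `r = (q, p)` it acts by
`(D_r ψ)(x) = exp(i(⟪p, x⟫ - ⟪p, q⟫ / 2)) ψ(x - q)`. -/
def displacement {m : ℕ} (r : PhaseSpace m) (ψ : ModeSpace m) : ModeSpace m :=
  (memLp_displacedWave r ψ).toLp (displacedWave r ψ)

/-- The vacuum wave function `x ↦ π^{-m/4} exp(-‖x‖² / 2)`. -/
def vacuumWave (m : ℕ) (x : ConfigSpace m) : ℂ :=
  ((Real.pi ^ (-(m : ℝ) / 4) * Real.exp (-‖x‖ ^ 2 / 2) : ℝ) : ℂ)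

theorem memLp_vacuumWave (m : ℕ) :
    MemLp (vacuumWave m) 2 (volume : Measure (ConfigSpace m)) := by
  have hc : Continuous (vacuumWave m) := by unfold vacuumWave; fun_prop
  rw [memLp_two_iff_integrable_sq_norm hc.aestronglyMeasurable]
  have h := (GaussianFourier.integrable_cexp_neg_mul_sq_norm_add (V := ConfigSpace m)
    (b := 1) (by simp) 0 0).norm.const_mul ((Real.pi ^ (-(m : ℝ) / 4)) ^ 2)
  refine h.congr (Filter.Eventually.of_forall fun x => ?_)
  have h1 : (-1 * (‖x‖ : ℂ) ^ 2 + 0 * ((inner ℝ (0 : ConfigSpace m) x : ℝ) : ℂ)) =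
      ((-‖x‖ ^ 2 : ℝ) : ℂ) := by push_cast; ring
  simp only [vacuumWave]
  rw [h1, Complex.norm_exp_ofReal, Complex.norm_real, Real.norm_eq_abs, sq_abs, mul_pow,
    ← Real.exp_nat_mul]
  congr 2
  push_cast
  ring

/-- The coherent state with first moment `r`; the vacuum is the case `r = 0`. -/
def coherentState {m : ℕ} (r : PhaseSpace m) : ModeSpace m :=
  displacement r ((memLp_vacuumWave m).toLp (vacuumWave m))

/-- `U` is a symplectic Gaussian unitary `U_S`: it implements `U_S† R̂ U_S = S R̂`, written in
exponentiated form as `U_S D_r = D_{S r} U_S`. This determines `U_S` up to a global phase. -/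
def IsSymplecticUnitary {m : ℕ} (S : QuadMatrix m) (U : ModeSpace m ≃ₗᵢ[ℂ] ModeSpace m) : Prop :=
  ∀ (r : PhaseSpace m) (ψ : ModeSpace m),
    U (displacement r ψ) = displacement (WithLp.toLp 2 (S *ᵥ r.ofLp)) (U ψ)

/-- `G` is the Gaussian unitary `G_{r,S} = D_r U_S`. -/
def IsGaussianUnitary {m : ℕ} (r : PhaseSpace m) (S : QuadMatrix m)
    (G : ModeSpace m ≃ₗᵢ[ℂ] ModeSpace m) : Prop :=
  ∃ U : ModeSpace m ≃ₗᵢ[ℂ] ModeSpace m,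
    IsSymplecticUnitary S U ∧ ∀ ψ : ModeSpace m, G ψ = displacement r (U ψ)

/-- The outcome law of heterodyne detection on a pure state `ψ`, that is, of the coherent-state
measurement `(2π)^{-m} |ξ⟩⟨ξ| dξ`. For a Gaussian state with first moment `μ` and covariance
matrix `V` (normalised by `V = 1` for the vacuum) it is the Gaussian law with mean `μ` and
covariance `(V + 1) / 2`. -/
def heterodyneLaw {m : ℕ} (ψ : ModeSpace m) : Measure (PhaseSpace m) :=
  volume.withDensity fun ξ =>
    ENNReal.ofReal (((2 * Real.pi) ^ m)⁻¹ * ‖inner ℂ (coherentState ξ) ψ‖ ^ 2)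

/-! # Estimation protocols with coherent probes and heterodyne detection -/

/-- A nonadaptive protocol. In each shot the coherent state with first moment `probe s` is sent
through one use of the unknown unitary and the output is measured by heterodyne detection;
`estimate` turns the list of all outcomes into a matrix. -/
structure CoherentProtocol (m : ℕ) where
  Shot : Type
  [fintypeShot : Fintype Shot]
  probe : Shot → PhaseSpace m
  estimate : (Shot → PhaseSpace m) → QuadMatrix m

attribute [instance] CoherentProtocol.fintypeShot

/-- The number of uses of the unknown unitary: one per shot. -/
def CoherentProtocol.queryCount {m : ℕ} (P : CoherentProtocol m) : ℕ := Fintype.card P.Shot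

/-- The joint law of the (independent) outcomes when the unknown unitary is `G`. -/
def CoherentProtocol.outcomeLaw {m : ℕ} (P : CoherentProtocol m)
    (G : ModeSpace m ≃ₗᵢ[ℂ] ModeSpace m) : Measure (P.Shot → PhaseSpace m) :=
  Measure.pi fun s => heterodyneLaw (G (coherentState (P.probe s)))

/-- The empirical mean of `N` vectors. -/
def empiricalMean {m N : ℕ} (y : Fin N → PhaseSpace m) : PhaseSpace m :=
  (N : ℝ)⁻¹ • ∑ k, y k

/-- The matrix with prescribed columns. -/
def ofColumns {m : ℕ} (c : Quad m → PhaseSpace m) : QuadMatrix m :=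
  Matrix.of fun a i => c i a

/-- The vacuum-shared protocol: `N` shots with the vacuum (index `none`) and `N` shots with each
probe `|η e_i⟩` (index `some i`); the `i`-th column of the estimate is `(Ȳ_i - Ȳ_0) / η`. -/
def vacuumSharedProtocol (m : ℕ) (η : ℝ) (N : ℕ) : CoherentProtocol m where
  Shot := Option (Quad m) × Fin N
  probe s := s.1.elim 0 fun i => EuclideanSpace.single i η
  estimate y := ofColumns fun i =>
    η⁻¹ • (empiricalMean (fun k => y (some i, k)) - empiricalMean (fun k => y (none, k)))

/-- The symmetric-probe protocol: `N` shots with each of the probes `|η e_i⟩` (flag `true`) and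
`|-η e_i⟩` (flag `false`); the `i`-th column of the estimate is `(Ȳ_i⁺ - Ȳ_i⁻) / (2η)`. -/
def symmetricProbeProtocol (m : ℕ) (η : ℝ) (N : ℕ) : CoherentProtocol m where
  Shot := (Quad m × Bool) × Fin N
  probe s := EuclideanSpace.single s.1.1 (if s.1.2 then η else -η)
  estimate y := ofColumns fun i =>
    (2 * η)⁻¹ •
      (empiricalMean (fun k => y ((i, true), k)) - empiricalMean (fun k => y ((i, false), k)))

/-! # Symplectic regularization -/

/-- `X` is the principal square root of the real matrix `A`: it is a square root all of whose
complex eigenvalues lie in the open right half-plane. There is at most one such `X`. -/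
def IsPrincipalSqrt {n : Type*} [Fintype n] [DecidableEq n] (X A : Matrix n n ℝ) : Prop :=
  X * X = A ∧ ∀ μ ∈ spectrum ℂ (X.map (algebraMap ℝ ℂ)), 0 < μ.re

open Classical in
/-- The principal square root of `A` if there is one, and `0` otherwise. -/
def principalSqrt {n : Type*} [Fintype n] [DecidableEq n] (A : Matrix n n ℝ) : Matrix n n ℝ :=
  if h : ∃ X, IsPrincipalSqrt X A then h.choose else 0

/-- `T = -Ω Ŝᵀ Ω Ŝ`. -/
def symplecticDefect {m : ℕ} (Shat : QuadMatrix m) : QuadMatrix m :=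
  -(omegaForm m * Shatᵀ * omegaForm m * Shat)

/-- The regularization of `Ŝ` is well defined: the principal square root of `T` exists. -/
def IsRegularizable {m : ℕ} (Shat : QuadMatrix m) : Prop :=
  ∃ Q, IsPrincipalSqrt Q (symplecticDefect Shat)

/-- The symplectic regularization `S̃ = Ŝ Q⁻¹` with `Q = √T`. -/
def symplecticRegularization {m : ℕ} (Shat : QuadMatrix m) : QuadMatrix m :=
  Shat * (principalSqrt (symplecticDefect Shat))⁻¹

/-- The outcomes of a protocol for which the regularized estimate `S̃` is well defined, exactly
symplectic, and within operator-norm distance `τ` of `S`. -/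
def CoherentProtocol.successEvent {m : ℕ} (P : CoherentProtocol m) (S : QuadMatrix m) (τ : ℝ) :
    Set (P.Shot → PhaseSpace m) :=
  {y | IsRegularizable (P.estimate y) ∧
    symplecticRegularization (P.estimate y) ∈ Matrix.symplecticGroup (Fin m) ℝ ∧
    ‖symplecticRegularization (P.estimate y) - S‖ ≤ τ}

end

/-! The proof joins a deterministic stability statement to a concentration statement; they meet at
the accuracy `τ / (4 * z ^ 2)` demanded of the raw estimate.

Algebra. The matrix `T` satisfies `J * T = Aᵀ * J * A`, where `A` is the raw estimate, so `T` is
fixed by the symplectic adjoint `X ↦ -J Xᵀ J`. Principal square roots are unique, because a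
Sylvester equation with disjoint spectra has only the zero solution; hence `Q` is fixed as well, and
dividing it out is a polar decomposition relative to the symplectic form
(`symplecticRegularization_mem`). If `A` is near `S`, then `T` is near `1`, a contraction produces a
root near `1`, and the regularized matrix stays near `S` (`isRegularizable_and_norm_sub_le`).

Outcome law. For every pure state the heterodyne characteristic function is `exp (-‖t‖² / 4)` times
the expectation of the displacement by `J t` (`charFun_heterodyneLaw`): Plancherel handles the
momentum integral and a convolution the position integral. For `G` applied to a coherent state the
Weyl relations evaluate that expectation, so all marginals are Gaussian, with mean `r + S s` and
variance at most `z² ‖t‖²`. Both estimates are linear in the outcomes, with weights that cancel `r`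
and reproduce `S`; their errors are therefore linear statistics of independent subgaussian noise.

Concentration. The vacuum-shared columns are correlated, so they are bounded one at a time, at the
cost of a factor `√(2m)` in the norm (`measure_norm_matrix_gt_le_of_columns`). The symmetric columns
use disjoint shots, so the error is subgaussian in every direction with a parameter free of the
dimension, and the operator norm is controlled directly (`measure_norm_matrix_ge_le`). The constants
324 and 81 leave room for the constants of these tail bounds. -/

noncomputable section

/-! # Principal square roots and symplectic regularization -/

section SquareRoot

variable {n : Type*} [Fintype n] [DecidableEq n]

/-- Uniqueness in the Sylvester equation: matrices with disjoint spectra have no intertwiner. -/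
theorem Matrix.eq_zero_of_mul_eq_mul_of_disjoint_spectrum {A B Z : Matrix n n ℂ}
    (h : A * Z = Z * B) (hd : Disjoint (spectrum ℂ A) (spectrum ℂ B)) : Z = 0 := by
  rcases isEmpty_or_nonempty n with hn | hn
  · exact Subsingleton.elim _ _
  have hp : ∀ p : Polynomial ℂ, Polynomial.aeval A p * Z = Z * Polynomial.aeval B p := by
    intro p
    induction p using Polynomial.induction_on' with
    | add p q hp hq => simp only [map_add, add_mul, mul_add, hp, hq]
    | monomial k a =>
      have hk : A ^ k * Z = Z * B ^ k := by
        induction k with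
        | zero => simp
        | succ k ih => rw [pow_succ, pow_succ, mul_assoc, h, ← mul_assoc, ih, mul_assoc]
      simp only [Polynomial.aeval_monomial, mul_assoc, hk]
      rw [← mul_assoc, Algebra.commutes, mul_assoc]
  -- Cayley–Hamilton kills the right-hand side, while spectral mapping makes the characteristic
  -- polynomial of `B` invertible at `A`.
  have h0 := hp B.charpoly
  rw [Matrix.aeval_self_charpoly, mul_zero] at h0
  have hu : IsUnit (Polynomial.aeval A B.charpoly) := by
    rw [← spectrum.zero_notMem_iff ℂ, spectrum.map_polynomial_aeval]
    rintro ⟨k, hk, hk0⟩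
    exact Set.disjoint_left.1 hd hk (Matrix.mem_spectrum_iff_isRoot_charpoly.2 hk0)
  exact hu.mul_right_eq_zero.1 h0

/-- From `X² = Y²` follows `X (X - Y) = (X - Y) (-Y)`, and `X`, `-Y` have spectra in opposite open
half-planes, so the intertwiner `X - Y` vanishes. -/
theorem IsPrincipalSqrt.unique {X Y A : Matrix n n ℝ} (hX : IsPrincipalSqrt X A)
    (hY : IsPrincipalSqrt Y A) : X = Y := by
  have hinj : Function.Injective (fun M : Matrix n n ℝ => M.map (algebraMap ℝ ℂ)) :=
    Matrix.map_injective (algebraMap ℝ ℂ).injective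
  apply hinj
  have hXY : (X.map (algebraMap ℝ ℂ)) * (X.map (algebraMap ℝ ℂ)) =
      (Y.map (algebraMap ℝ ℂ)) * (Y.map (algebraMap ℝ ℂ)) := by
    rw [← Matrix.map_mul, ← Matrix.map_mul, hX.1, hY.1]
  have h2X := hX.2
  have h2Y := hY.2
  show X.map (algebraMap ℝ ℂ) = Y.map (algebraMap ℝ ℂ)
  generalize X.map (algebraMap ℝ ℂ) = X' at *
  generalize Y.map (algebraMap ℝ ℂ) = Y' at *
  rw [← sub_eq_zero]
  refine Matrix.eq_zero_of_mul_eq_mul_of_disjoint_spectrum (A := X') (B := -Y') ?_ ?_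
  · simp only [mul_sub, sub_mul, mul_neg, hXY]
    abel
  · refine Set.disjoint_left.2 fun k hk hk' => ?_
    rw [← spectrum.neg_eq, Set.mem_neg] at hk'
    have := h2X k hk
    have := h2Y _ hk'
    rw [Complex.neg_re] at this
    linarith

theorem IsPrincipalSqrt.principalSqrt_eq {X A : Matrix n n ℝ} (hX : IsPrincipalSqrt X A) :
    principalSqrt A = X := by
  have h : ∃ X, IsPrincipalSqrt X A := ⟨X, hX⟩
  rw [principalSqrt, dif_pos h]
  exact h.choose_spec.unique hX

theorem IsPrincipalSqrt.isUnit {X A : Matrix n n ℝ} (hX : IsPrincipalSqrt X A) : IsUnit X := by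
  by_contra h
  have h0 : (0 : ℂ) ∈ spectrum ℂ (X.map (algebraMap ℝ ℂ)) := by
    rw [spectrum.zero_mem_iff, Matrix.isUnit_iff_isUnit_det]
    rw [Matrix.isUnit_iff_isUnit_det, isUnit_iff_ne_zero, not_not] at h
    have : (X.map (algebraMap ℝ ℂ)).det = algebraMap ℝ ℂ X.det := (RingHom.map_det _ _).symm
    rw [this, h]
    simp
  simpa using hX.2 0 h0

theorem Matrix.spectrum_transpose (A : Matrix n n ℂ) : spectrum ℂ Aᵀ = spectrum ℂ A := by
  ext k
  rw [Matrix.mem_spectrum_iff_isRoot_charpoly, Matrix.mem_spectrum_iff_isRoot_charpoly,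
    Matrix.charpoly_transpose]

/-- A real matrix within operator-norm distance `ρ < 1` of the identity has its complex spectrum in
the open right half-plane. -/
theorem Matrix.re_pos_of_mem_spectrum_one_add {X : Matrix n n ℝ} {ρ : ℝ} (hρ : ρ < 1)
    (hX : ‖X‖ ≤ ρ) {k : ℂ} (hk : k ∈ spectrum ℂ ((1 + X).map (algebraMap ℝ ℂ))) : 0 < k.re := by
  have h1 : (1 + X).map (algebraMap ℝ ℂ) = 1 + X.map (algebraMap ℝ ℂ) := by
    ext i j
    simp [Matrix.one_apply, apply_ite]
  rw [spectrum.mem_iff, Matrix.isUnit_iff_isUnit_det, isUnit_iff_ne_zero, not_not,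
    ← Matrix.exists_mulVec_eq_zero_iff] at hk
  obtain ⟨v, hv, hkv⟩ := hk
  have hXv : ∀ i, (X.map (algebraMap ℝ ℂ) *ᵥ v) i = (k - 1) * v i := by
    intro i
    have := congrFun hkv i
    rw [h1, Matrix.sub_mulVec, Matrix.add_mulVec, Matrix.one_mulVec,
      Algebra.algebraMap_eq_smul_one, Matrix.smul_mulVec, Matrix.one_mulVec] at this
    simp only [Pi.sub_apply, Pi.add_apply, Pi.smul_apply, smul_eq_mul, Pi.zero_apply] at this
    linear_combination -this
  -- The norm hypothesis concerns real vectors, so the complex eigenvector is split into real and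
  -- imaginary parts, whose squared norms add up.
  set a : EuclideanSpace ℝ n := WithLp.toLp 2 fun i => (v i).re with ha
  set b : EuclideanSpace ℝ n := WithLp.toLp 2 fun i => (v i).im with hb
  have hre : ∀ i, (X *ᵥ a.ofLp) i = ((k - 1) * v i).re := by
    intro i
    rw [← hXv i]
    simp [Matrix.mulVec, dotProduct, ha]
  have him : ∀ i, (X *ᵥ b.ofLp) i = ((k - 1) * v i).im := by
    intro i
    rw [← hXv i]
    simp [Matrix.mulVec, dotProduct, hb]
  have hsum : ‖(WithLp.toLp 2 (X *ᵥ a.ofLp) : EuclideanSpace ℝ n)‖ ^ 2 +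
      ‖(WithLp.toLp 2 (X *ᵥ b.ofLp) : EuclideanSpace ℝ n)‖ ^ 2 =
      ‖k - 1‖ ^ 2 * (‖a‖ ^ 2 + ‖b‖ ^ 2) := by
    simp only [EuclideanSpace.real_norm_sq_eq, ← Finset.sum_add_distrib, Finset.mul_sum]
    refine Finset.sum_congr rfl fun i _ => ?_
    rw [hre, him, Complex.sq_norm, Complex.normSq_apply, Complex.mul_re, Complex.mul_im]
    ring
  have hpos : 0 < ‖a‖ ^ 2 + ‖b‖ ^ 2 := by
    obtain ⟨i, hi⟩ := Function.ne_iff.1 hv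
    simp only [EuclideanSpace.real_norm_sq_eq, ← Finset.sum_add_distrib]
    refine Finset.sum_pos' (fun _ _ => by positivity) ⟨i, Finset.mem_univ _, ?_⟩
    have := Complex.normSq_pos.2 hi
    rw [Complex.normSq_apply] at this
    simp only [ha, hb]
    nlinarith
  have ha' := (Matrix.l2_opNorm_mulVec X a).trans (mul_le_mul_of_nonneg_right hX (norm_nonneg a))
  have hb' := (Matrix.l2_opNorm_mulVec X b).trans (mul_le_mul_of_nonneg_right hX (norm_nonneg b))
  have ha2 := pow_le_pow_left₀ (norm_nonneg _) ha' 2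
  have hb2 := pow_le_pow_left₀ (norm_nonneg _) hb' 2
  have hρ0 : 0 ≤ ρ := (norm_nonneg X).trans hX
  have hle : ‖k - 1‖ ^ 2 ≤ ρ ^ 2 := by
    refine le_of_mul_le_mul_right ?_ hpos
    rw [← hsum]
    calc _ ≤ (ρ * ‖a‖) ^ 2 + (ρ * ‖b‖) ^ 2 := add_le_add ha2 hb2
      _ = _ := by ring
  have hlt : ‖k - 1‖ < 1 := (abs_le_of_sq_le_sq' hle hρ0 |>.2).trans_lt hρ
  have := (Complex.abs_re_le_norm (k - 1)).trans_lt hlt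
  rw [abs_lt, Complex.sub_re, Complex.one_re] at this
  linarith

/-- A matrix close to the identity has a principal square root, found as a fixed point of
`X ↦ (H - X²) / 2`. -/
theorem exists_isPrincipalSqrt_one_add {H : Matrix n n ℝ} {ρ : ℝ} (hρ0 : 0 ≤ ρ) (hρ : ρ < 1)
    (hH : ‖H‖ + ρ ^ 2 ≤ 2 * ρ) :
    ∃ X : Matrix n n ℝ, ‖X‖ ≤ ρ ∧ IsPrincipalSqrt (1 + X) (1 + H) := by
  let f : Matrix n n ℝ → Matrix n n ℝ := fun X => (2⁻¹ : ℝ) • (H - X * X)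
  have hs : IsComplete (Metric.closedBall (0 : Matrix n n ℝ) ρ) :=
    Metric.isClosed_closedBall.isComplete
  -- Invariance of the ball of radius `ρ` is what `hH` provides; the contraction constant is again
  -- `ρ`, by factoring `X² - Y²` as `X (X - Y) + (X - Y) Y`.
  have hmaps : Set.MapsTo f (Metric.closedBall 0 ρ) (Metric.closedBall 0 ρ) := by
    intro X hX
    rw [mem_closedBall_zero_iff] at hX ⊢
    have h1 : ‖H - X * X‖ ≤ ‖H‖ + ρ ^ 2 :=
      (norm_sub_le _ _).trans (by nlinarith [norm_mul_le X X, norm_nonneg X])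
    simp only [f, norm_smul, norm_inv, Real.norm_ofNat]
    linarith
  have hc : ContractingWith ⟨ρ, hρ0⟩ (hmaps.restrict f _ _) := by
    refine ⟨by exact_mod_cast hρ, LipschitzWith.of_dist_le_mul fun X Y => ?_⟩
    obtain ⟨X, hX⟩ := X
    obtain ⟨Y, hY⟩ := Y
    rw [mem_closedBall_zero_iff] at hX hY
    simp only [Subtype.dist_eq, Set.MapsTo.val_restrict_apply, dist_eq_norm, f]
    have e : (2⁻¹ : ℝ) • (H - X * X) - (2⁻¹ : ℝ) • (H - Y * Y) =
        -((2⁻¹ : ℝ) • (X * (X - Y) + (X - Y) * Y)) := by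
      rw [← smul_sub, ← smul_neg]
      congr 1
      noncomm_ring
    rw [e, norm_neg, norm_smul, norm_inv, Real.norm_ofNat]
    show _ ≤ ρ * ‖X - Y‖
    have h1 := norm_add_le (X * (X - Y)) ((X - Y) * Y)
    have h2 := norm_mul_le X (X - Y)
    have h3 := norm_mul_le (X - Y) Y
    have h4 := norm_nonneg (X - Y)
    nlinarith [mul_le_mul_of_nonneg_right hX h4, mul_le_mul_of_nonneg_left hY h4]
  obtain ⟨X, hX, hfix, -⟩ := hc.exists_fixedPoint' hs hmaps
    (Metric.mem_closedBall_self hρ0) (edist_ne_top _ _)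
  rw [mem_closedBall_zero_iff] at hX
  refine ⟨X, hX, ?_, fun k hk => Matrix.re_pos_of_mem_spectrum_one_add hρ hX hk⟩
  have h2 : H - X * X = X + X := by
    have h := congrArg (fun M => (2 : ℝ) • M) hfix.eq
    simp only [f, smul_smul] at h
    rw [mul_inv_cancel₀ two_ne_zero, one_smul, two_smul] at h
    exact h
  have : H = X + X + X * X := by rw [← h2]; abel
  rw [this]
  noncomm_ring

end SquareRoot

/-! ### Symplectic adjoint, exactness of the regularization and its stability -/

section Symplectic

variable {m : ℕ}

theorem symplecticDefect_eq (A : QuadMatrix m) :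
    symplecticDefect A = -(Matrix.J (Fin m) ℝ * Aᵀ * Matrix.J (Fin m) ℝ * A) := by
  simp [symplecticDefect, omegaForm]

theorem J_mul_symplecticDefect (A : QuadMatrix m) :
    Matrix.J (Fin m) ℝ * symplecticDefect A = Aᵀ * Matrix.J (Fin m) ℝ * A := by
  rw [symplecticDefect_eq, mul_neg]
  simp only [← mul_assoc, Matrix.J_squared]
  simp

/-- The symplectic adjoint `X ↦ -J Xᵀ J` maps principal square roots of `symplecticDefect A` to
themselves. -/
theorem IsPrincipalSqrt.symplecticAdjoint {A Q : QuadMatrix m}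
    (hQ : IsPrincipalSqrt Q (symplecticDefect A)) :
    IsPrincipalSqrt (-(Matrix.J (Fin m) ℝ * Qᵀ * Matrix.J (Fin m) ℝ)) (symplecticDefect A) := by
  have hJ := Matrix.J_squared (Fin m) ℝ
  refine ⟨?_, ?_⟩
  · have h1 : -(Matrix.J (Fin m) ℝ * Qᵀ * Matrix.J (Fin m) ℝ) *
        -(Matrix.J (Fin m) ℝ * Qᵀ * Matrix.J (Fin m) ℝ) =
        Matrix.J (Fin m) ℝ * Qᵀ * (Matrix.J (Fin m) ℝ * Matrix.J (Fin m) ℝ) * Qᵀ *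
          Matrix.J (Fin m) ℝ := by noncomm_ring
    have h2 : Qᵀ * Qᵀ = Aᵀ * Matrix.J (Fin m) ℝ * A * -(Matrix.J (Fin m) ℝ) := by
      rw [← Matrix.transpose_mul, hQ.1, symplecticDefect_eq]
      simp only [Matrix.transpose_neg, Matrix.transpose_mul, Matrix.transpose_transpose,
        Matrix.J_transpose]
      noncomm_ring
    rw [h1, hJ, symplecticDefect_eq]
    calc _ = -(Matrix.J (Fin m) ℝ * (Qᵀ * Qᵀ) * Matrix.J (Fin m) ℝ) := by noncomm_ring
      _ = Matrix.J (Fin m) ℝ * (Aᵀ * Matrix.J (Fin m) ℝ * A) *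
          (Matrix.J (Fin m) ℝ * Matrix.J (Fin m) ℝ) := by rw [h2]; noncomm_ring
      _ = _ := by rw [hJ]; noncomm_ring
  · have hJC := Matrix.J_squared (Fin m) ℂ
    -- Since `J⁻¹ = -J`, the symplectic adjoint is a transpose followed by a similarity, and both
    -- preserve the spectrum.
    let u : (Matrix (Quad m) (Quad m) ℂ)ˣ :=
      ⟨-Matrix.J (Fin m) ℂ, Matrix.J (Fin m) ℂ, by rw [neg_mul, hJC, neg_neg],
        by rw [mul_neg, hJC, neg_neg]⟩
    have hmap : (-(Matrix.J (Fin m) ℝ * Qᵀ * Matrix.J (Fin m) ℝ)).map (algebraMap ℝ ℂ) =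
        u * (Q.map (algebraMap ℝ ℂ))ᵀ * (u⁻¹ : (Matrix (Quad m) (Quad m) ℂ)ˣ) := by
      have hm := Matrix.map_J (l := Fin m) (algebraMap ℝ ℂ)
      show _ = -Matrix.J (Fin m) ℂ * (Q.map (algebraMap ℝ ℂ))ᵀ * Matrix.J (Fin m) ℂ
      rw [← hm, Matrix.map_neg _ (fun x => by simp), Matrix.map_mul, Matrix.map_mul,
        Matrix.transpose_map, neg_mul, neg_mul]
    rw [hmap, spectrum.units_conjugate, Matrix.spectrum_transpose]
    exact hQ.2

/-- Uniqueness forces `Q` to equal its symplectic adjoint, that is `Qᵀ J = J Q`. With `Aᵀ J A = J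
Q²`, one factor `Q` then moves to the left as `Qᵀ`, and both inverses cancel. -/
theorem symplecticRegularization_mem {A : QuadMatrix m} (hA : IsRegularizable A) :
    symplecticRegularization A ∈ Matrix.symplecticGroup (Fin m) ℝ := by
  obtain ⟨Q, hQ⟩ := hA
  rw [symplecticRegularization, hQ.principalSqrt_eq, SymplecticGroup.mem_iff']
  have hdet : IsUnit Q.det := (Matrix.isUnit_iff_isUnit_det _).1 hQ.isUnit
  have hJQ : Qᵀ * Matrix.J (Fin m) ℝ = Matrix.J (Fin m) ℝ * Q := by
    have h := congrArg (fun M => Matrix.J (Fin m) ℝ * M) (hQ.symplecticAdjoint.unique hQ)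
    simp only [mul_neg, ← mul_assoc, Matrix.J_squared] at h
    simpa using h
  have h1 : (Q⁻¹)ᵀ * Qᵀ = 1 := by
    rw [← Matrix.transpose_mul, Matrix.mul_nonsing_inv _ hdet, Matrix.transpose_one]
  calc (A * Q⁻¹)ᵀ * Matrix.J (Fin m) ℝ * (A * Q⁻¹)
      = (Q⁻¹)ᵀ * (Aᵀ * Matrix.J (Fin m) ℝ * A) * Q⁻¹ := by
        rw [Matrix.transpose_mul]; simp only [mul_assoc]
    _ = (Q⁻¹)ᵀ * (Matrix.J (Fin m) ℝ * (Q * Q)) * Q⁻¹ := by rw [← J_mul_symplecticDefect, hQ.1]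
    _ = (Q⁻¹)ᵀ * (Qᵀ * Matrix.J (Fin m) ℝ) * (Q * Q⁻¹) := by rw [hJQ]; simp only [mul_assoc]
    _ = Matrix.J (Fin m) ℝ := by
        rw [← mul_assoc (Q⁻¹)ᵀ, h1, one_mul, Matrix.mul_nonsing_inv _ hdet, mul_one]

theorem norm_one_le_one {n : Type*} [Fintype n] [DecidableEq n] :
    ‖(1 : Matrix n n ℝ)‖ ≤ 1 := by
  rcases isEmpty_or_nonempty n with hn | hn
  · rw [Subsingleton.elim (1 : Matrix n n ℝ) 0, norm_zero]
    exact zero_le_one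
  · exact norm_one.le

theorem norm_J_le_one : ‖Matrix.J (Fin m) ℝ‖ ≤ 1 := by
  have h := Matrix.l2_opNorm_conjTranspose_mul_self (Matrix.J (Fin m) ℝ)
  rw [Matrix.conjTranspose_eq_transpose_of_trivial, Matrix.J_transpose, neg_mul,
    Matrix.J_squared, neg_neg] at h
  nlinarith [norm_one_le_one (n := Quad m), norm_nonneg (Matrix.J (Fin m) ℝ)]

theorem norm_transpose (A : QuadMatrix m) : ‖Aᵀ‖ = ‖A‖ := by
  rw [← Matrix.conjTranspose_eq_transpose_of_trivial, Matrix.l2_opNorm_conjTranspose]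

/-- Taking norms in `1 = -J Sᵀ J S` gives `1 ≤ ‖S‖²`. This supplies `1 ≤ z`, which the main theorem
does not assume; for `m = 0` it would fail. -/
theorem one_le_norm_of_mem_symplecticGroup [NeZero m] {S : QuadMatrix m}
    (hS : S ∈ Matrix.symplecticGroup (Fin m) ℝ) : 1 ≤ ‖S‖ := by
  have h1 : (1 : QuadMatrix m) = -(Matrix.J (Fin m) ℝ * Sᵀ * Matrix.J (Fin m) ℝ * S) :=
    (SymplecticGroup.inv_left_mul_aux hS).symm
  have h2 : (1 : ℝ) ≤ ‖Matrix.J (Fin m) ℝ‖ * ‖S‖ * ‖Matrix.J (Fin m) ℝ‖ * ‖S‖ := by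
    have : ‖(1 : QuadMatrix m)‖ = 1 := norm_one
    rw [← this, h1, norm_neg]
    refine (norm_mul_le _ _).trans (mul_le_mul_of_nonneg_right ?_ (norm_nonneg _))
    refine (norm_mul_le _ _).trans (mul_le_mul_of_nonneg_right ?_ (norm_nonneg _))
    exact (norm_mul_le _ _).trans (by rw [norm_transpose])
  have hJ := norm_J_le_one (m := m)
  have hJ0 := norm_nonneg (Matrix.J (Fin m) ℝ)
  have hS0 := norm_nonneg S
  by_contra hlt
  push Not at hlt
  have h3 : ‖Matrix.J (Fin m) ℝ‖ * ‖S‖ ≤ ‖S‖ := by nlinarith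
  have h4 : 0 ≤ ‖Matrix.J (Fin m) ℝ‖ * ‖S‖ := by positivity
  nlinarith

/-- With `A = S + E` the zeroth-order term of the defect is `1` because `S` is symplectic; two
linear terms and one quadratic term in `E` remain, and factors `J` cost nothing in norm. -/
theorem norm_symplecticDefect_sub_one_le {S A : QuadMatrix m} {z ε : ℝ}
    (hS : S ∈ Matrix.symplecticGroup (Fin m) ℝ) (hz : ‖S‖ ≤ z) (hA : ‖A - S‖ ≤ ε) :
    ‖symplecticDefect A - 1‖ ≤ 2 * z * ε + ε ^ 2 := by
  obtain ⟨E, rfl⟩ : ∃ E, A = S + E := ⟨A - S, by abel⟩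
  rw [add_sub_cancel_left] at hA
  have h1 : symplecticDefect (S + E) - 1 =
      -(Matrix.J (Fin m) ℝ * (Sᵀ * (Matrix.J (Fin m) ℝ * E) + Eᵀ * (Matrix.J (Fin m) ℝ * S) +
        Eᵀ * (Matrix.J (Fin m) ℝ * E))) := by
    have h2 := SymplecticGroup.inv_left_mul_aux hS
    rw [symplecticDefect_eq, Matrix.transpose_add, ← h2]
    noncomm_ring
  have hJ : ∀ M : QuadMatrix m, ‖Matrix.J (Fin m) ℝ * M‖ ≤ ‖M‖ := fun M =>
    (norm_mul_le _ _).trans (mul_le_of_le_one_left (norm_nonneg _) norm_J_le_one)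
  have hz0 := (norm_nonneg _).trans hz
  have hε0 := (norm_nonneg _).trans hA
  have hprod : ∀ (M K : QuadMatrix m) {a b : ℝ}, ‖M‖ ≤ a → ‖K‖ ≤ b → 0 ≤ a →
      ‖Mᵀ * (Matrix.J (Fin m) ℝ * K)‖ ≤ a * b := fun M K _ _ ha hb h0 =>
    ((norm_mul_le Mᵀ _).trans (mul_le_mul ((norm_transpose M).trans_le ha) ((hJ K).trans hb)
      (norm_nonneg _) h0))
  rw [h1, norm_neg]
  refine (hJ _).trans ((norm_add₃_le).trans ?_)
  have e1 := hprod S E hz hA hz0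
  have e2 := hprod E S hA hz hε0
  have e3 := hprod E E hA hA hε0
  nlinarith

/-- Stability of the symplectic regularization under perturbations of size `τ / (4 z²)`. -/
theorem isRegularizable_and_norm_sub_le {S A : QuadMatrix m} {z τ : ℝ}
    (hS : S ∈ Matrix.symplecticGroup (Fin m) ℝ) (hz : ‖S‖ ≤ z) (hz1 : 1 ≤ z) (hτ0 : 0 < τ)
    (hτ1 : τ < 1) (hA : ‖A - S‖ ≤ τ / (4 * z ^ 2)) :
    IsRegularizable A ∧ ‖symplecticRegularization A - S‖ ≤ τ := by
  have hz0 : 0 < z := by linarith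
  obtain ⟨u, hu⟩ : ∃ u, u = τ / z := ⟨_, rfl⟩
  have hτu : τ = u * z := by rw [hu]; field_simp
  have hu0 : 0 < u := by rw [hu]; positivity
  have hu1 : u ≤ 1 := by rw [hu, div_le_one hz0]; linarith
  -- This `ρ` makes `z * ρ * (1 + u) = 3 * τ / 4`. The final requirement `ε + z * ρ ≤ τ * (1 - ρ)`
  -- then reads `ε ≤ τ / 4`, while `ρ` is still large enough for the fixed-point condition `hbound`.
  obtain ⟨ρ, hρ⟩ : ∃ ρ, ρ = 3 * u / (4 * (1 + u)) := ⟨_, rfl⟩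
  have hρu : ρ * (1 + u) = 3 * u / 4 := by rw [hρ]; field_simp
  have hρ0 : 0 < ρ := by rw [hρ]; positivity
  have hρ1 : ρ < 1 := by nlinarith
  obtain ⟨ε, hε⟩ : ∃ ε, ε = τ / (4 * z ^ 2) := ⟨_, rfl⟩
  rw [← hε] at hA
  have hεz : ε * z = u / 4 := by rw [hε, hτu]; field_simp
  have hε0 : 0 < ε := by rw [hε]; positivity
  have hεu : ε ≤ u / 4 := by nlinarith
  have hH := norm_symplecticDefect_sub_one_le hS hz hA
  have hbound : ‖symplecticDefect A - 1‖ + ρ ^ 2 ≤ 2 * ρ := by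
    have h1 : 2 * z * ε + ε ^ 2 ≤ 9 / 16 * u := by nlinarith
    have h2 : 9 / 16 * u + ρ ^ 2 ≤ 2 * ρ := by
      have hle : ρ ≤ 3 * u / 4 := by nlinarith
      rw [← mul_le_mul_iff_left₀ (show 0 < (1 + u) ^ 2 by positivity)]
      have e1 : (9 / 16 * u + ρ ^ 2) * (1 + u) ^ 2 =
          9 / 16 * u * (1 + u) ^ 2 + (ρ * (1 + u)) ^ 2 := by ring
      have e2 : 2 * ρ * (1 + u) ^ 2 = 2 * (ρ * (1 + u)) * (1 + u) := by ring
      rw [e1, e2, hρu]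
      nlinarith [mul_nonneg hu0.le (sub_nonneg.2 hu1), mul_nonneg (mul_nonneg hu0.le hu0.le) (sub_nonneg.2 hu1)]
    linarith
  obtain ⟨X, hX, hQ⟩ := exists_isPrincipalSqrt_one_add hρ0.le hρ1 hbound
  rw [add_sub_cancel] at hQ
  refine ⟨⟨_, hQ⟩, ?_⟩
  rw [symplecticRegularization, hQ.principalSqrt_eq]
  set Q := 1 + X with hQdef
  have hdet : IsUnit Q.det := (Matrix.isUnit_iff_isUnit_det _).1 hQ.isUnit
  -- Neumann-type bound, obtained without a series from `Q⁻¹ = 1 - X Q⁻¹`.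
  have hinv : ‖Q⁻¹‖ * (1 - ρ) ≤ 1 := by
    have h1 : Q⁻¹ = 1 - X * Q⁻¹ := by
      rw [eq_sub_iff_add_eq]
      calc Q⁻¹ + X * Q⁻¹ = Q * Q⁻¹ := by rw [hQdef, add_mul, one_mul]
        _ = 1 := Matrix.mul_nonsing_inv _ hdet
    have h2 : ‖Q⁻¹‖ ≤ 1 + ρ * ‖Q⁻¹‖ := by
      conv_lhs => rw [h1]
      refine (norm_sub_le _ _).trans (add_le_add norm_one_le_one ?_)
      exact (norm_mul_le _ _).trans (mul_le_mul_of_nonneg_right hX (norm_nonneg _))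
    linarith
  have hdiff : A * Q⁻¹ - S = (A - S - S * X) * Q⁻¹ := by
    have : S = S * Q * Q⁻¹ := by rw [mul_assoc, Matrix.mul_nonsing_inv _ hdet, mul_one]
    conv_lhs => rw [this]
    rw [← sub_mul, hQdef, mul_add, mul_one]
    congr 1
    abel
  have h3 : ‖A - S - S * X‖ ≤ τ * (1 - ρ) := by
    refine (norm_sub_le _ _).trans ?_
    have h4 : ‖S * X‖ ≤ z * ρ :=
      (norm_mul_le _ _).trans (mul_le_mul hz hX (norm_nonneg _) hz0.le)
    have h5 : ε + z * ρ ≤ τ * (1 - ρ) := by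
      rw [hτu]
      have e : u * z * (1 - ρ) - z * ρ = z * (u - ρ * (1 + u)) := by ring
      rw [hρu] at e
      nlinarith
    linarith
  rw [hdiff]
  calc ‖(A - S - S * X) * Q⁻¹‖ ≤ τ * (1 - ρ) * ‖Q⁻¹‖ :=
        (norm_mul_le _ _).trans (mul_le_mul_of_nonneg_right h3 (norm_nonneg _))
    _ = τ * (‖Q⁻¹‖ * (1 - ρ)) := by ring
    _ ≤ τ := mul_le_of_le_one_right hτ0.le hinv

end Symplectic

/-! # Concentration of subgaussian random vectors and matrices -/

section Concentration

open ProbabilityTheory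
open scoped NNReal ENNReal

variable {Ω : Type*} [MeasurableSpace Ω] {μ : Measure Ω}
  {ι : Type*} [Fintype ι]

theorem lintegral_exp_neg_mul_sq_norm {b : ℝ} (hb : 0 < b) :
    ∫⁻ v : EuclideanSpace ℝ ι, ENNReal.ofReal (Real.exp (-b * ‖v‖ ^ 2)) =
      ENNReal.ofReal ((Real.pi / b) ^ (Fintype.card ι / 2 : ℝ)) := by
  have h := GaussianFourier.integral_rexp_neg_mul_sq_norm (V := EuclideanSpace ℝ ι) hb
  rw [finrank_euclideanSpace] at h
  rw [← h, ofReal_integral_eq_lintegral_ofReal _ (ae_of_all _ fun _ => (Real.exp_pos _).le)]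
  refine Integrable.of_integral_ne_zero ?_
  rw [h]
  positivity

/-- Completing the square. Read from right to left, it writes the exponential of a squared norm as a
Gaussian average of exponentials of linear forms, to which subgaussian bounds apply. -/
theorem lintegral_exp_neg_mul_sq_norm_add_inner {b : ℝ} (hb : 0 < b) (w : EuclideanSpace ℝ ι) :
    ∫⁻ v : EuclideanSpace ℝ ι, ENNReal.ofReal (Real.exp (-b * ‖v‖ ^ 2 + inner ℝ v w)) =
      ENNReal.ofReal ((Real.pi / b) ^ (Fintype.card ι / 2 : ℝ)) *
        ENNReal.ofReal (Real.exp (‖w‖ ^ 2 / (4 * b))) := by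
  have hpt : ∀ v : EuclideanSpace ℝ ι, ENNReal.ofReal (Real.exp (-b * ‖v‖ ^ 2 + inner ℝ v w)) =
      ENNReal.ofReal (Real.exp (-b * ‖v - (2 * b)⁻¹ • w‖ ^ 2)) *
        ENNReal.ofReal (Real.exp (‖w‖ ^ 2 / (4 * b))) := by
    intro v
    rw [← ENNReal.ofReal_mul (Real.exp_pos _).le, ← Real.exp_add, norm_sub_sq_real,
      inner_smul_right, norm_smul, Real.norm_of_nonneg (by positivity)]
    congr 2
    field_simp
    ring
  simp_rw [hpt]
  rw [lintegral_mul_const' _ _ ENNReal.ofReal_ne_top,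
    lintegral_sub_right_eq_self
      (fun v : EuclideanSpace ℝ ι => ENNReal.ofReal (Real.exp (-b * ‖v‖ ^ 2))),
    lintegral_exp_neg_mul_sq_norm hb]

/-- Exponential integrability of the squared norm of a subgaussian vector, by linearising the
square with an auxiliary Gaussian integral. -/
theorem lintegral_exp_sq_norm_le [SFinite μ] {X : Ω → EuclideanSpace ℝ ι} (hX : Measurable X)
    {c : ℝ≥0} (hc : 0 < c)
    (h : ∀ t, HasSubgaussianMGF (fun ω => inner ℝ t (X ω)) (c * ‖t‖₊ ^ 2) μ) :
    ∫⁻ ω, ENNReal.ofReal (Real.exp (‖X ω‖ ^ 2 / (4 * c))) ∂μ ≤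
      ENNReal.ofReal (2 ^ (Fintype.card ι / 2 : ℝ)) := by
  have hc' : (0 : ℝ) < c := hc
  set a := ENNReal.ofReal ((Real.pi / c) ^ (Fintype.card ι / 2 : ℝ)) with ha
  have ha0 : a ≠ 0 := by
    rw [ha, Ne, ENNReal.ofReal_eq_zero, not_le]
    positivity
  have hat : a ≠ ∞ := ENNReal.ofReal_ne_top
  have hmeas : Measurable fun p : Ω × EuclideanSpace ℝ ι =>
      ENNReal.ofReal (Real.exp (-(c : ℝ) * ‖p.2‖ ^ 2 + inner ℝ p.2 (X p.1))) := by
    have hX1 : Measurable fun p : Ω × EuclideanSpace ℝ ι => X p.1 := hX.comp measurable_fst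
    fun_prop
  rw [← ENNReal.mul_le_mul_iff_right ha0 hat, ← lintegral_const_mul' _ _ hat]
  simp_rw [ha, ← lintegral_exp_neg_mul_sq_norm_add_inner hc']
  rw [lintegral_lintegral_swap hmeas.aemeasurable]
  -- The moment bound `exp (c ‖g‖² / 2)` uses up half of the Gaussian weight `exp (-c ‖g‖²)`;
  -- doubling the variance in each coordinate is the source of the factor `2 ^ (n / 2)`.
  calc ∫⁻ g : EuclideanSpace ℝ ι, ∫⁻ ω,
          ENNReal.ofReal (Real.exp (-(c : ℝ) * ‖g‖ ^ 2 + inner ℝ g (X ω))) ∂μ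
      ≤ ∫⁻ g : EuclideanSpace ℝ ι, ENNReal.ofReal (Real.exp (-(c / 2 : ℝ) * ‖g‖ ^ 2)) := by
        refine lintegral_mono fun g => ?_
        have h1 := (h g).mgf_le 1
        have h2 := (h g).integrable_exp_mul 1
        simp only [one_mul, mgf] at h1 h2
        simp_rw [Real.exp_add, ENNReal.ofReal_mul (Real.exp_pos _).le]
        rw [lintegral_const_mul' _ _ ENNReal.ofReal_ne_top,
          ← ofReal_integral_eq_lintegral_ofReal h2 (ae_of_all _ fun _ => (Real.exp_pos _).le),
          ← ENNReal.ofReal_mul (Real.exp_pos _).le]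
        refine ENNReal.ofReal_le_ofReal
          ((mul_le_mul_of_nonneg_left h1 (Real.exp_pos _).le).trans_eq ?_)
        rw [← Real.exp_add]
        congr 1
        push_cast
        ring
    _ = _ := by
        rw [lintegral_exp_neg_mul_sq_norm (by positivity), ← ENNReal.ofReal_mul (by positivity),
          ← Real.mul_rpow (by positivity) (by positivity)]
        congr 2
        field_simp

/-- Markov's inequality for the exponential of the squared norm. -/
theorem measure_norm_ge_le [SFinite μ] {X : Ω → EuclideanSpace ℝ ι} (hX : Measurable X)
    {c : ℝ≥0} (hc : 0 < c)
    (h : ∀ t, HasSubgaussianMGF (fun ω => inner ℝ t (X ω)) (c * ‖t‖₊ ^ 2) μ)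
    {R : ℝ} (hR : 0 ≤ R) :
    μ {ω | R ≤ ‖X ω‖} ≤
      ENNReal.ofReal (2 ^ (Fintype.card ι / 2 : ℝ) * Real.exp (-(R ^ 2 / (4 * c)))) := by
  have h1 := mul_meas_ge_le_lintegral (μ := μ)
    (f := fun ω => ENNReal.ofReal (Real.exp (‖X ω‖ ^ 2 / (4 * c)))) (by fun_prop)
    (ENNReal.ofReal (Real.exp (R ^ 2 / (4 * c))))
  have h2 := h1.trans (lintegral_exp_sq_norm_le hX hc h)
  rw [Real.exp_neg, ← div_eq_mul_inv, ENNReal.ofReal_div_of_pos (Real.exp_pos _),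
    ENNReal.le_div_iff_mul_le (Or.inl (by simp [Real.exp_pos]))
      (Or.inl ENNReal.ofReal_ne_top), mul_comm]
  refine le_trans (mul_le_mul_right ?_ _) h2
  refine measure_mono fun ω hω => ENNReal.ofReal_le_ofReal (Real.exp_le_exp.2 ?_)
  have hω' : R ≤ ‖X ω‖ := hω
  gcongr

variable [DecidableEq ι]

/-- The norm is attained by compactness of the closed unit ball; unit vectors are not asked for, as
there are none when `ι` is empty. -/
theorem Matrix.exists_norm_le_one_and_norm_le (M : Matrix ι ι ℝ) :
    ∃ v : EuclideanSpace ℝ ι, ‖v‖ ≤ 1 ∧ ‖M‖ ≤ ‖Matrix.toEuclideanCLM (𝕜 := ℝ) M v‖ := by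
  obtain ⟨v, hv, hmax⟩ := (isCompact_closedBall (0 : EuclideanSpace ℝ ι) 1).exists_isMaxOn
    ⟨0, by simp⟩ (f := fun v => ‖Matrix.toEuclideanCLM (𝕜 := ℝ) M v‖) (by fun_prop)
  refine ⟨v, by simpa using hv, ?_⟩
  rw [Matrix.cstar_norm_def]
  refine ContinuousLinearMap.opNorm_le_of_unit_norm (norm_nonneg _) fun x hx => ?_
  exact hmax (by simp [hx])

/-- A subgaussian random matrix has operator norm of the order of the square root of its size. The
union bound over a net is replaced by an average over the unit ball. -/
theorem measure_norm_matrix_ge_le [IsProbabilityMeasure μ] {E : Ω → Matrix ι ι ℝ}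
    (hE : ∀ i j, Measurable fun ω => E ω i j) {c : ℝ≥0} (hc : 0 < c)
    (h : ∀ v : EuclideanSpace ℝ ι, ‖v‖ ≤ 1 → ∀ t : EuclideanSpace ℝ ι, HasSubgaussianMGF
      (fun ω => inner ℝ t (Matrix.toEuclideanCLM (𝕜 := ℝ) (E ω) v)) (c * ‖t‖₊ ^ 2) μ)
    {K : ℝ} (hK : 0 ≤ K) :
    μ {ω | K ≤ ‖E ω‖} ≤ ENNReal.ofReal (8 ^ Fintype.card ι *
      (2 ^ (Fintype.card ι / 2 : ℝ) * Real.exp (-((3 / 4 * K) ^ 2 / (4 * c))))) := by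
  set B : Set (EuclideanSpace ℝ ι) := Metric.closedBall 0 1 with hB
  set p := ENNReal.ofReal
    (2 ^ (Fintype.card ι / 2 : ℝ) * Real.exp (-((3 / 4 * K) ^ 2 / (4 * c)))) with hp
  have hmeas : Measurable fun q : Ω × EuclideanSpace ℝ ι =>
      Matrix.toEuclideanCLM (𝕜 := ℝ) (E q.1) q.2 := by
    have h1 : ∀ i j, Measurable fun q : Ω × EuclideanSpace ℝ ι => E q.1 i j := fun i j =>
      (hE i j).comp measurable_fst
    refine (WithLp.measurable_toLp 2 (ι → ℝ)).comp
      (g := WithLp.toLp 2) (f := fun q : Ω × EuclideanSpace ℝ ι => E q.1 *ᵥ q.2.ofLp)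
      (measurable_pi_iff.2 fun i => ?_)
    simp only [Matrix.mulVec, dotProduct]
    fun_prop
  set A : Set (Ω × EuclideanSpace ℝ ι) :=
    {q | 3 / 4 * K ≤ ‖Matrix.toEuclideanCLM (𝕜 := ℝ) (E q.1) q.2‖} with hA
  have hAm : MeasurableSet A := measurableSet_le measurable_const hmeas.norm
  have hvol0 : volume B ≠ 0 := (Metric.measure_closedBall_pos volume _ one_pos).ne'
  have hvolt : volume B ≠ ∞ := measure_closedBall_lt_top.ne
  have hball : ∀ x : EuclideanSpace ℝ ι, volume (Metric.closedBall x (1 / 8)) =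
      ENNReal.ofReal ((1 / 8) ^ Fintype.card ι) * volume B := by
    intro x
    rw [Measure.addHaar_closedBall _ _ (by norm_num), finrank_euclideanSpace, hB,
      Measure.addHaar_closedBall _ _ zero_le_one]
    simp
  -- Fubini in both orders: for fixed `v` the probability is small, whereas for fixed `ω` with large
  -- `‖E ω‖` a fixed fraction of the unit ball is bad.
  have hupper : (μ.prod (volume.restrict B)) A ≤ p * volume B := by
    rw [Measure.prod_apply_symm hAm]
    calc _ ≤ ∫⁻ _ in B, p := by
          refine setLIntegral_mono measurable_const fun v hv => ?_
          have hv' : ‖v‖ ≤ 1 := by simpa [hB] using hv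
          exact measure_norm_ge_le (hmeas.comp measurable_prodMk_right) hc (h v hv')
            (by positivity)
      _ = p * volume B := by rw [setLIntegral_const]
  have hlower : ENNReal.ofReal ((1 / 8) ^ Fintype.card ι) * volume B * μ {ω | K ≤ ‖E ω‖} ≤
      (μ.prod (volume.restrict B)) A := by
    rw [Measure.prod_apply hAm]
    refine le_trans (mul_le_mul_right (measure_mono fun ω hω => ?_) _)
      (mul_meas_ge_le_lintegral (measurable_measure_prodMk_left hAm) _)
    -- For a maximising `v`, the ball of radius `1/8` about `(7/8) v` lies in the unit ball, and on
    -- it the image has norm at least `(7/8 - 1/8) ‖E ω‖`. Its share of the volume is `8 ^ (-n)`.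
    obtain ⟨v, hv, hMv⟩ := (E ω).exists_norm_le_one_and_norm_le
    have hω' : K ≤ ‖E ω‖ := hω
    rw [Set.mem_ofPred_eq, Measure.restrict_apply (measurable_prodMk_left hAm),
      ← hball ((7 / 8 : ℝ) • v)]
    refine measure_mono fun x hx => ?_
    rw [mem_closedBall_iff_norm] at hx
    obtain ⟨y, rfl⟩ : ∃ y, x = (7 / 8 : ℝ) • v + y := ⟨x - (7 / 8 : ℝ) • v, by abel⟩
    rw [add_sub_cancel_left] at hx
    refine ⟨?_, ?_⟩
    · show 3 / 4 * K ≤ ‖Matrix.toEuclideanCLM (𝕜 := ℝ) (E ω) ((7 / 8 : ℝ) • v + y)‖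
      rw [map_add, map_smul]
      have h1 := norm_sub_le_norm_add
        ((7 / 8 : ℝ) • Matrix.toEuclideanCLM (𝕜 := ℝ) (E ω) v) (Matrix.toEuclideanCLM (𝕜 := ℝ) (E ω) y)
      have h2 := (Matrix.toEuclideanCLM (𝕜 := ℝ) (E ω)).le_opNorm y
      rw [← Matrix.cstar_norm_def] at h2
      rw [norm_smul, Real.norm_of_nonneg (by norm_num)] at h1
      nlinarith [norm_nonneg (E ω)]
    · rw [hB, mem_closedBall_zero_iff]
      have h1 := norm_add_le ((7 / 8 : ℝ) • v) y
      rw [norm_smul, Real.norm_of_nonneg (by norm_num)] at h1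
      linarith
  have h3 := hlower.trans hupper
  rw [mul_right_comm, ENNReal.mul_le_mul_iff_left hvol0 hvolt] at h3
  have h8 : ENNReal.ofReal (8 ^ Fintype.card ι) * ENNReal.ofReal ((1 / 8) ^ Fintype.card ι) = 1 := by
    rw [← ENNReal.ofReal_mul (by positivity), ← mul_pow]
    norm_num
  calc μ {ω | K ≤ ‖E ω‖} = ENNReal.ofReal (8 ^ Fintype.card ι) *
        (ENNReal.ofReal ((1 / 8) ^ Fintype.card ι) * μ {ω | K ≤ ‖E ω‖}) := by
        rw [← mul_assoc, h8, one_mul]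
    _ ≤ ENNReal.ofReal (8 ^ Fintype.card ι) * p := mul_le_mul_right h3 _
    _ = _ := by rw [hp, ← ENNReal.ofReal_mul (by positivity)]

theorem Matrix.toEuclideanCLM_apply_eq_sum (M : Matrix ι ι ℝ) (x : EuclideanSpace ℝ ι) :
    Matrix.toEuclideanCLM (𝕜 := ℝ) M x =
      ∑ i, x i • (WithLp.toLp 2 (M.col i) : EuclideanSpace ℝ ι) := by
  ext j
  simp [Matrix.mulVec, dotProduct, mul_comm]

/-- Triangle inequality over the columns, then Cauchy–Schwarz between the `ℓ¹` and `ℓ²` norms of the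
coefficients. -/
theorem Matrix.l2_opNorm_le_of_columns (M : Matrix ι ι ℝ) {R : ℝ} (hR : 0 ≤ R)
    (h : ∀ i, ‖(WithLp.toLp 2 (M.col i) : EuclideanSpace ℝ ι)‖ ≤ R) :
    ‖M‖ ≤ √(Fintype.card ι) * R := by
  rw [Matrix.cstar_norm_def]
  refine ContinuousLinearMap.opNorm_le_bound _ (by positivity) fun x => ?_
  rw [Matrix.toEuclideanCLM_apply_eq_sum]
  calc _ ≤ ∑ i, ‖x i‖ * R := (norm_sum_le _ _).trans (Finset.sum_le_sum fun i _ => by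
        rw [norm_smul]; exact mul_le_mul_of_nonneg_left (h i) (norm_nonneg _))
    _ = (∑ i, ‖x i‖) * R := by rw [Finset.sum_mul]
    _ ≤ (√(Fintype.card ι) * ‖x‖) * R := by
        refine mul_le_mul_of_nonneg_right ?_ hR
        refine abs_le_of_sq_le_sq' ?_ (by positivity) |>.2
        rw [mul_pow, Real.sq_sqrt (by positivity), EuclideanSpace.norm_sq_eq]
        exact sq_sum_le_card_mul_sum_sq
    _ = _ := by ring

/-- A union bound over columns: only each column separately must be subgaussian, so correlations
between columns, such as those from shared vacuum shots, do no harm. -/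
theorem measure_norm_matrix_gt_le_of_columns [IsProbabilityMeasure μ] {E : Ω → Matrix ι ι ℝ}
    (hE : ∀ i j, Measurable fun ω => E ω i j) {c : ℝ≥0} (hc : 0 < c)
    (h : ∀ (i : ι) (t : EuclideanSpace ℝ ι), HasSubgaussianMGF
      (fun ω => inner ℝ t (WithLp.toLp 2 ((E ω).col i))) (c * ‖t‖₊ ^ 2) μ)
    {R : ℝ} (hR : 0 ≤ R) :
    μ {ω | √(Fintype.card ι) * R < ‖E ω‖} ≤ ENNReal.ofReal (Fintype.card ι *
      (2 ^ (Fintype.card ι / 2 : ℝ) * Real.exp (-(R ^ 2 / (4 * c))))) := by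
  calc μ {ω | √(Fintype.card ι) * R < ‖E ω‖}
      ≤ μ (⋃ i, {ω | R ≤ ‖(WithLp.toLp 2 ((E ω).col i) : EuclideanSpace ℝ ι)‖}) := by
        refine measure_mono fun ω hω => ?_
        by_contra hn
        simp only [Set.mem_iUnion, Set.mem_ofPred_eq, not_exists, not_le] at hn hω
        exact hω.not_ge ((E ω).l2_opNorm_le_of_columns hR fun i => (hn i).le)
    _ ≤ ∑ i, μ {ω | R ≤ ‖(WithLp.toLp 2 ((E ω).col i) : EuclideanSpace ℝ ι)‖} :=
        measure_iUnion_fintype_le _ _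
    _ ≤ ∑ _i : ι, ENNReal.ofReal (2 ^ (Fintype.card ι / 2 : ℝ) * Real.exp (-(R ^ 2 / (4 * c)))) := by
        refine Finset.sum_le_sum fun i _ => measure_norm_ge_le ?_ hc (h i) hR
        exact (WithLp.measurable_toLp 2 _).comp (measurable_pi_iff.2 fun j => hE j i)
    _ = _ := by
        rw [Finset.sum_const, Finset.card_univ, nsmul_eq_mul,
          ENNReal.ofReal_mul (Nat.cast_nonneg _), ENNReal.ofReal_natCast]

end Concentration

/-! # Plancherel for functions in `L¹ ∩ L²` -/

section Plancherel

open scoped FourierTransform SchwartzMap ContDiff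

variable {V : Type*} [NormedAddCommGroup V] [InnerProductSpace ℝ V] [FiniteDimensional ℝ V]
  [MeasurableSpace V] [BorelSpace V]

theorem continuous_fourier_of_integrable {f : V → ℂ} (hf : Integrable f) : Continuous (𝓕 f) :=
  VectorFourier.fourierIntegral_continuous Real.continuous_fourierChar
    (by exact continuous_inner) hf

/-- On `L¹ ∩ L²` the `L²` Fourier transform is given by the Fourier integral. -/
theorem coeFn_fourier_toLp_ae_eq {f : V → ℂ} (hf1 : Integrable f) (hf2 : MemLp f 2) :
    (𝓕 (hf2.toLp f) : Lp ℂ 2 (volume : Measure V)) =ᵐ[volume] 𝓕 f := by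
  have hcont := continuous_fourier_of_integrable hf1
  refine ae_eq_of_integral_contDiff_smul_eq
    ((Lp.memLp _).locallyIntegrable (by norm_num)) hcont.locallyIntegrable fun g hg hgs => ?_
  have hgC : ContDiff ℝ ∞ fun x => (g x : ℂ) := Complex.ofRealCLM.contDiff.comp hg
  have hgsC : HasCompactSupport fun x => (g x : ℂ) := hgs.comp_left Complex.ofReal_zero
  -- Testing against smooth compactly supported functions, the transform is moved onto the test
  -- function on both sides: by compatibility with tempered distributions for `L²`, by Fubini for
  -- `L¹`.
  set G : 𝓢(V, ℂ) := hgsC.toSchwartzMap hgC with hG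
  have hGx : ∀ x, G x = (g x : ℂ) := fun x => rfl
  have h1 := congrArg (fun T => T G) (Lp.fourier_toTemperedDistribution_eq (hf2.toLp f))
  simp only [TemperedDistribution.fourier_apply, Lp.toTemperedDistribution_apply] at h1
  have h2 : ∀ φ : V → ℂ, ∫ x, g x • φ x = ∫ x, G x • φ x := fun φ => by
    simp only [hGx, Complex.real_smul, smul_eq_mul]
  rw [h2, h2, ← h1]
  have h3 := VectorFourier.integral_fourierIntegral_smul_eq_flip (μ := (volume : Measure V))
    (ν := (volume : Measure V)) (L := innerₗ V) (f := f) (g := G) Real.continuous_fourierChar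
    (by exact continuous_inner) hf1 G.integrable
  rw [flip_innerₗ] at h3
  calc ∫ x, (𝓕 G) x • (hf2.toLp f) x = ∫ x, f x • (𝓕 G) x := by
        refine integral_congr_ae ?_
        filter_upwards [hf2.coeFn_toLp] with x hx
        rw [hx, smul_eq_mul, smul_eq_mul, mul_comm]
    _ = ∫ x, (𝓕 f) x • G x := by
        rw [SchwartzMap.fourier_coe]
        exact h3.symm
    _ = ∫ x, G x • (𝓕 f) x := by simp only [smul_eq_mul, mul_comm]

theorem memLp_fourier {f : V → ℂ} (hf1 : Integrable f) (hf2 : MemLp f 2) : MemLp (𝓕 f) 2 :=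
  (memLp_congr_ae (coeFn_fourier_toLp_ae_eq hf1 hf2)).1 (Lp.memLp _)

theorem integral_inner_fourier_fourier {f g : V → ℂ} (hf1 : Integrable f) (hf2 : MemLp f 2)
    (hg1 : Integrable g) (hg2 : MemLp g 2) :
    ∫ w, inner ℂ (𝓕 f w) (𝓕 g w) = ∫ x, inner ℂ (f x) (g x) := by
  have h := Lp.inner_fourier_eq (hf2.toLp f) (hg2.toLp g)
  rw [L2.inner_def, L2.inner_def] at h
  calc _ = ∫ w, inner ℂ ((𝓕 (hf2.toLp f) : Lp ℂ 2 (volume : Measure V)) w)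
        ((𝓕 (hg2.toLp g) : Lp ℂ 2 (volume : Measure V)) w) := by
        refine integral_congr_ae ?_
        filter_upwards [coeFn_fourier_toLp_ae_eq hf1 hf2, coeFn_fourier_toLp_ae_eq hg1 hg2]
          with w h1 h2
        rw [h1, h2]
    _ = _ := by
        rw [h]
        refine integral_congr_ae ?_
        filter_upwards [hf2.coeFn_toLp, hg2.coeFn_toLp] with w h1 h2
        rw [h1, h2]

theorem fourier_comp_add_right (f : V → ℂ) (a w : V) :
    𝓕 (fun x => f (x + a)) w = Complex.exp (Complex.I * (2 * Real.pi * inner ℝ a w : ℝ)) * 𝓕 f w := by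
  have h := congrFun (VectorFourier.fourierIntegral_comp_add_right Real.fourierChar
    (volume : Measure V) (innerₗ V) f a) w
  refine Eq.trans h ?_
  rw [Circle.smul_def, smul_eq_mul, Real.fourierChar_apply, innerₗ_apply_apply]
  congr 2
  push_cast
  ring

/-- The correlation form of Plancherel's theorem, in the angular-frequency normalisation. -/
theorem integral_exp_mul_norm_fourier_sq {f : V → ℂ} (hf1 : Integrable f) (hf2 : MemLp f 2)
    (a : V) :
    ∫ p : V, Complex.exp (Complex.I * (inner ℝ a p : ℝ)) *
        ((‖𝓕 f ((2 * Real.pi)⁻¹ • p)‖ ^ 2 : ℝ) : ℂ) =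
      (2 * Real.pi) ^ Module.finrank ℝ V * ∫ x, inner ℂ (f x) (f (x + a)) := by
  have hpi : (0 : ℝ) ≤ 2 * Real.pi := by positivity
  have h := Measure.integral_comp_inv_smul_of_nonneg (volume : Measure V)
    (fun w : V => Complex.exp (Complex.I * (2 * Real.pi * inner ℝ a w : ℝ)) *
      ((‖𝓕 f w‖ ^ 2 : ℝ) : ℂ)) hpi
  have hmp := measurePreserving_add_right (volume : Measure V) a
  have hg1 : Integrable (fun x => f (x + a)) := hf1.comp_add_right a
  have hg2 : MemLp (fun x => f (x + a)) 2 := hf2.comp_measurePreserving hmp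
  rw [← integral_inner_fourier_fourier hf1 hf2 hg1 hg2]
  simp only [Complex.real_smul, Complex.ofReal_pow, Complex.ofReal_mul, Complex.ofReal_ofNat] at h
  calc _ = ∫ p : V, Complex.exp (Complex.I *
          (2 * Real.pi * (inner ℝ a ((2 * Real.pi)⁻¹ • p) : ℝ))) *
        (‖𝓕 f ((2 * Real.pi)⁻¹ • p)‖ : ℂ) ^ 2 := by
        refine integral_congr_ae (ae_of_all _ fun p => ?_)
        simp only [inner_smul_right]
        push_cast
        congr 3
        field_simp
    _ = _ := by
        rw [h]
        congr 1
        refine integral_congr_ae (ae_of_all _ fun w => ?_)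
        simp only [fourier_comp_add_right]
        rw [← smul_eq_mul _ (𝓕 f w), inner_smul_right, inner_self_eq_norm_sq_to_K]
        push_cast
        rfl

theorem integrable_norm_fourier_sq {f : V → ℂ} (hf1 : Integrable f) (hf2 : MemLp f 2) :
    Integrable fun p : V => ‖𝓕 f ((2 * Real.pi)⁻¹ • p)‖ ^ 2 := by
  have h := ((memLp_two_iff_integrable_sq_norm (memLp_fourier hf1 hf2).1).1
    (memLp_fourier hf1 hf2))
  exact h.comp_smul (by positivity)

end Plancherel

/-! # Displacement operators and coherent states -/

section Displacement

open scoped FourierTransform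

variable {m : ℕ}

theorem coeFn_displacement (r : PhaseSpace m) (ψ : ModeSpace m) :
    displacement r ψ =ᵐ[volume] displacedWave r ψ :=
  (memLp_displacedWave r ψ).coeFn_toLp

theorem displacedWave_congr_ae (r : PhaseSpace m) {f g : ConfigSpace m → ℂ}
    (h : f =ᵐ[volume] g) : displacedWave r f =ᵐ[volume] displacedWave r g := by
  have h' := (measurePreserving_sub_right (volume : Measure (ConfigSpace m))
    (positionPart r)).quasiMeasurePreserving.ae_eq_comp h
  filter_upwards [h'] with x hx
  simp only [Function.comp_apply] at hx
  simp only [displacedWave, hx]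

theorem coeFn_coherentState (r : PhaseSpace m) :
    coherentState r =ᵐ[volume] displacedWave r (vacuumWave m) :=
  (coeFn_displacement r _).trans (displacedWave_congr_ae r (memLp_vacuumWave m).coeFn_toLp)

theorem inner_displacedWave (r : PhaseSpace m) (f g : ConfigSpace m → ℂ) (x : ConfigSpace m) :
    inner ℂ (displacedWave r f x) (displacedWave r g x) =
      inner ℂ (f (x - positionPart r)) (g (x - positionPart r)) := by
  rw [RCLike.inner_apply, RCLike.inner_apply, displacedWave, displacedWave, map_mul,
    mul_mul_mul_comm, Complex.mul_conj', mul_comm Complex.I, Complex.norm_exp_ofReal_mul_I]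
  simp

theorem inner_displacement_displacement (r : PhaseSpace m) (φ ψ : ModeSpace m) :
    inner ℂ (displacement r φ) (displacement r ψ) = inner ℂ φ ψ := by
  rw [L2.inner_def, L2.inner_def]
  rw [← integral_sub_right_eq_self (fun x => inner ℂ (φ x) (ψ x)) (positionPart r)]
  refine integral_congr_ae ?_
  filter_upwards [coeFn_displacement r φ, coeFn_displacement r ψ] with x h1 h2
  rw [h1, h2, inner_displacedWave]

/-- The symplectic phase in the Weyl relation. -/
def symplecticPhase (t r : PhaseSpace m) : ℝ :=
  inner ℝ (momentumPart t) (positionPart r) - inner ℝ (positionPart t) (momentumPart r)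

/-- Both orders translate by the same total vector, so only phases differ; the symmetric half-phases
agree and the cross terms leave the symplectic form. -/
theorem displacement_comm (t r : PhaseSpace m) (ψ : ModeSpace m) :
    displacement t (displacement r ψ) =
      Complex.exp (Complex.I * (symplecticPhase t r : ℝ)) •
        displacement r (displacement t ψ) := by
  refine Lp.ext ?_
  filter_upwards [coeFn_displacement t (displacement r ψ),
    coeFn_displacement r (displacement t ψ),
    displacedWave_congr_ae t (coeFn_displacement r ψ),
    displacedWave_congr_ae r (coeFn_displacement t ψ),
    Lp.coeFn_smul (Complex.exp (Complex.I * (symplecticPhase t r : ℝ)))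
      (displacement r (displacement t ψ))] with x h1 h2 h3 h4 h5
  rw [h5, Pi.smul_apply, h1, h2, h3, h4]
  simp only [displacedWave, symplecticPhase, smul_eq_mul, inner_sub_right]
  rw [sub_right_comm x]
  simp only [← mul_assoc, ← Complex.exp_add]
  congr 2
  rw [real_inner_comm (momentumPart r) (positionPart t)]
  push_cast
  ring

theorem inner_displacement_conj (t r : PhaseSpace m) (ψ : ModeSpace m) :
    inner ℂ (displacement r ψ) (displacement t (displacement r ψ)) =
      Complex.exp (Complex.I * (symplecticPhase t r : ℝ)) * inner ℂ ψ (displacement t ψ) := by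
  rw [displacement_comm, inner_smul_right, inner_displacement_displacement]

/-! ### The vacuum -/

theorem continuous_vacuumWave : Continuous (vacuumWave m) := by
  unfold vacuumWave
  fun_prop

theorem vacuumWave_mul_vacuumWave (x y : ConfigSpace m) :
    vacuumWave m x * vacuumWave m y =
      ((Real.pi ^ (-(m : ℝ) / 2) * Real.exp (-(‖x‖ ^ 2 + ‖y‖ ^ 2) / 2) : ℝ) : ℂ) := by
  rw [vacuumWave, vacuumWave, ← Complex.ofReal_mul, mul_mul_mul_comm, ← Real.exp_add,
    ← Real.rpow_add Real.pi_pos]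
  congr 3 <;> ring_nf

theorem conj_vacuumWave (x : ConfigSpace m) :
    (starRingEnd ℂ) (vacuumWave m x) = vacuumWave m x := Complex.conj_ofReal _

theorem vacuumWave_neg (x : ConfigSpace m) : vacuumWave m (-x) = vacuumWave m x := by
  simp [vacuumWave]

/-- The ambiguity function of the vacuum. -/
theorem integral_exp_mul_vacuumWave_mul (a b : ConfigSpace m) :
    ∫ y : ConfigSpace m, Complex.exp (Complex.I * (inner ℝ b y : ℝ)) *
        (vacuumWave m y * vacuumWave m (y - a)) =
      Complex.exp (Complex.I * (inner ℝ b a / 2 : ℝ)) *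
        Complex.exp (-((‖a‖ ^ 2 + ‖b‖ ^ 2) / 4 : ℝ)) := by
  have hG := GaussianFourier.integral_cexp_neg_mul_sq_norm_add (V := ConfigSpace m) (b := 1)
    (by simp) Complex.I b
  rw [finrank_euclideanSpace, Fintype.card_fin] at hG
  -- Recentring by `a / 2` symmetrises the two Gaussians, so their cross terms cancel and a single
  -- centred Gaussian integral is left.
  rw [← integral_add_right_eq_self _ ((2⁻¹ : ℝ) • a)]
  have hpt : ∀ y : ConfigSpace m,
      Complex.exp (Complex.I * (inner ℝ b (y + (2⁻¹ : ℝ) • a) : ℝ)) *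
        (vacuumWave m (y + (2⁻¹ : ℝ) • a) * vacuumWave m (y + (2⁻¹ : ℝ) • a - a)) =
      ((Real.pi ^ (-(m : ℝ) / 2) : ℝ) * (Complex.exp (Complex.I * (inner ℝ b a / 2 : ℝ)) *
        Complex.exp (-(‖a‖ ^ 2 / 4 : ℝ)))) *
        Complex.exp (-1 * (‖y‖ : ℂ) ^ 2 + Complex.I * (inner ℝ b y : ℝ)) := by
    intro y
    have e : y + (2⁻¹ : ℝ) • a - a = y - (2⁻¹ : ℝ) • a := by module
    rw [vacuumWave_mul_vacuumWave, e, norm_add_sq_real, norm_sub_sq_real, inner_add_right,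
      inner_smul_right, inner_smul_right, norm_smul, Real.norm_of_nonneg (by norm_num)]
    rw [Complex.ofReal_mul, Complex.ofReal_exp, mul_left_comm, mul_assoc]
    congr 1
    simp only [← Complex.exp_add]
    congr 1
    push_cast
    ring
  simp_rw [hpt]
  rw [integral_const_mul, hG]
  have hpi : ((Real.pi ^ (-(m : ℝ) / 2) : ℝ) : ℂ) * ((Real.pi : ℂ) / 1) ^ ((m : ℂ) / 2) = 1 := by
    rw [div_one, Complex.ofReal_cpow Real.pi_pos.le, ← Complex.cpow_add _ _ (by simp)]
    push_cast
    rw [neg_div, neg_add_cancel, Complex.cpow_zero]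
  calc _ = (((Real.pi ^ (-(m : ℝ) / 2) : ℝ) : ℂ) * ((Real.pi : ℂ) / 1) ^ ((m : ℂ) / 2)) *
        (Complex.exp (Complex.I * (inner ℝ b a / 2 : ℝ)) * (Complex.exp (-(‖a‖ ^ 2 / 4 : ℝ)) *
          Complex.exp (Complex.I ^ 2 * ‖b‖ ^ 2 / (4 * 1)))) := by ring
    _ = _ := by
      rw [hpi, one_mul, ← Complex.exp_add (-_)]
      congr 2
      rw [Complex.I_sq]
      push_cast
      ring

theorem inner_coherentState_eq_integral (ξ : PhaseSpace m) (ψ : ModeSpace m) :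
    inner ℂ (coherentState ξ) ψ =
      ∫ x, inner ℂ (displacedWave ξ (vacuumWave m) x) (ψ x) := by
  rw [L2.inner_def]
  refine integral_congr_ae ?_
  filter_upwards [coeFn_coherentState ξ] with x hx
  rw [hx]

theorem norm_sq_phaseSpace (t : PhaseSpace m) :
    ‖t‖ ^ 2 = ‖positionPart t‖ ^ 2 + ‖momentumPart t‖ ^ 2 := by
  simp [EuclideanSpace.real_norm_sq_eq, positionPart, momentumPart]

theorem inner_phaseSpace (s t : PhaseSpace m) :
    inner ℝ s t = inner ℝ (positionPart s) (positionPart t) +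
      inner ℝ (momentumPart s) (momentumPart t) := by
  simp [PiLp.inner_apply, positionPart, momentumPart]

/-- The vacuum characteristic function. -/
theorem inner_vacuum_displacement (t : PhaseSpace m) :
    inner ℂ ((memLp_vacuumWave m).toLp (vacuumWave m))
      (displacement t ((memLp_vacuumWave m).toLp (vacuumWave m))) =
      Complex.exp (-(‖t‖ ^ 2 / 4 : ℝ)) := by
  have h := integral_exp_mul_vacuumWave_mul (positionPart t) (momentumPart t)
  rw [norm_sq_phaseSpace, L2.inner_def]
  calc _ = ∫ y : ConfigSpace m,
        Complex.exp (-(Complex.I * (inner ℝ (momentumPart t) (positionPart t) / 2 : ℝ))) *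
        (Complex.exp (Complex.I * (inner ℝ (momentumPart t) y : ℝ)) *
        (vacuumWave m y * vacuumWave m (y - positionPart t))) := by
        refine integral_congr_ae ?_
        filter_upwards [(memLp_vacuumWave m).coeFn_toLp, coeFn_coherentState t] with x h1 h2
        rw [coherentState] at h2
        rw [h1, h2, RCLike.inner_apply, conj_vacuumWave, displacedWave, ← mul_assoc,
          ← Complex.exp_add, mul_right_comm, mul_assoc]
        congr 2
        push_cast
        ring
    _ = _ := by
        rw [integral_const_mul, h, ← mul_assoc, ← Complex.exp_add, neg_add_cancel,
          Complex.exp_zero, one_mul]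

/-- The windowed Fourier transform form of a coherent amplitude. -/
theorem norm_inner_coherentState (ξ : PhaseSpace m) (ψ : ModeSpace m) :
    ‖inner ℂ (coherentState ξ) ψ‖ =
      ‖𝓕 (fun x => vacuumWave m (x - positionPart ξ) * ψ x)
        ((2 * Real.pi)⁻¹ • momentumPart ξ)‖ := by
  rw [inner_coherentState_eq_integral, Real.fourier_eq]
  have hpt : ∀ x, inner ℂ (displacedWave ξ (vacuumWave m) x) (ψ x) =
      Complex.exp (((inner ℝ (momentumPart ξ) (positionPart ξ) / 2 : ℝ) : ℂ) * Complex.I) *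
      (Real.fourierChar (-inner ℝ x ((2 * Real.pi)⁻¹ • momentumPart ξ)) •
        (vacuumWave m (x - positionPart ξ) * ψ x)) := by
    intro x
    rw [RCLike.inner_apply, displacedWave, map_mul, conj_vacuumWave, ← Complex.exp_conj,
      Circle.smul_def, Real.fourierChar_apply, smul_eq_mul, ← mul_assoc (Complex.exp _),
      ← Complex.exp_add, mul_comm (ψ x), mul_assoc]
    congr 2
    rw [inner_smul_right, real_inner_comm]
    simp only [map_mul, Complex.conj_I, Complex.conj_ofReal]
    push_cast
    field_simp
    ring
  simp_rw [hpt]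
  rw [integral_const_mul, norm_mul, Complex.norm_exp_ofReal_mul_I, one_mul]

end Displacement

/-! # The characteristic function of the heterodyne law -/

section Heterodyne

open scoped FourierTransform Convolution

variable {m : ℕ}

/-- Phase space as the product of position and momentum space. -/
def phaseSpaceEquivProd (m : ℕ) : PhaseSpace m ≃ᵐ ConfigSpace m × ConfigSpace m :=
  (MeasurableEquiv.toLp 2 (Quad m → ℝ)).symm.trans <|
    (MeasurableEquiv.sumPiEquivProdPi fun _ : Quad m => ℝ).trans <|
      MeasurableEquiv.prodCongr (MeasurableEquiv.toLp 2 (Fin m → ℝ))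
        (MeasurableEquiv.toLp 2 (Fin m → ℝ))

theorem phaseSpaceEquivProd_apply (ξ : PhaseSpace m) :
    phaseSpaceEquivProd m ξ = (positionPart ξ, momentumPart ξ) := rfl

theorem measurePreserving_phaseSpaceEquivProd (m : ℕ) :
    MeasurePreserving (phaseSpaceEquivProd m) := by
  refine (EuclideanSpace.volume_preserving_symm_measurableEquiv_toLp _).trans ?_
  refine (volume_measurePreserving_sumPiEquivProdPi _).trans ?_
  exact (EuclideanSpace.volume_preserving_symm_measurableEquiv_toLp _).symm.prod
    (EuclideanSpace.volume_preserving_symm_measurableEquiv_toLp _).symm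

/-- The function `x ↦ g(x - q) ψ(x)` with the vacuum window `g`. -/
def windowed (ψ : ModeSpace m) (q x : ConfigSpace m) : ℂ := vacuumWave m (x - q) * ψ x

theorem memLp_vacuumWave_sub (q : ConfigSpace m) :
    MemLp (fun x => vacuumWave m (x - q)) 2 (volume : Measure (ConfigSpace m)) :=
  (memLp_vacuumWave m).comp_measurePreserving (measurePreserving_sub_right volume q)

theorem integrable_windowed (ψ : ModeSpace m) (q : ConfigSpace m) :
    Integrable (windowed ψ q) :=
  (memLp_vacuumWave_sub q).integrable_mul (Lp.memLp ψ)

theorem norm_vacuumWave_le (x : ConfigSpace m) :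
    ‖vacuumWave m x‖ ≤ Real.pi ^ (-(m : ℝ) / 4) := by
  rw [vacuumWave, Complex.norm_real, Real.norm_of_nonneg (by positivity)]
  refine mul_le_of_le_one_right (by positivity) (Real.exp_le_one_iff.2 ?_)
  have := sq_nonneg ‖x‖
  linarith

/-- Square integrability of the window puts the product in `L¹`, and its boundedness keeps the
product in `L²`; Plancherel for pointwise Fourier integrals needs both. -/
theorem memLp_windowed (ψ : ModeSpace m) (q : ConfigSpace m) :
    MemLp (windowed ψ q) 2 (volume : Measure (ConfigSpace m)) := by
  refine (Lp.memLp ψ).of_le_mul (c := Real.pi ^ (-(m : ℝ) / 4)) (integrable_windowed ψ q).1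
    (ae_of_all _ fun x => ?_)
  rw [windowed, norm_mul]
  exact mul_le_mul_of_nonneg_right (norm_vacuumWave_le _) (norm_nonneg _)

theorem stronglyMeasurable_fourier_windowed (ψ : ModeSpace m) :
    StronglyMeasurable fun z : ConfigSpace m × ConfigSpace m =>
      𝓕 (windowed ψ z.1) ((2 * Real.pi)⁻¹ • z.2) := by
  simp only [Real.fourier_eq]
  refine StronglyMeasurable.integral_prod_right'
    (f := fun w : (ConfigSpace m × ConfigSpace m) × ConfigSpace m =>
      Real.fourierChar (-inner ℝ w.2 ((2 * Real.pi)⁻¹ • w.1.2)) • windowed ψ w.1.1 w.2) ?_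
  have h1 : StronglyMeasurable fun w : (ConfigSpace m × ConfigSpace m) × ConfigSpace m =>
      ψ w.2 := (Lp.stronglyMeasurable ψ).comp_measurable measurable_snd
  have h2 : Continuous fun w : (ConfigSpace m × ConfigSpace m) × ConfigSpace m =>
      vacuumWave m (w.2 - w.1.1) := continuous_vacuumWave.comp (by fun_prop)
  have h3 : Continuous fun w : (ConfigSpace m × ConfigSpace m) × ConfigSpace m =>
      ((Real.fourierChar (-inner ℝ w.2 ((2 * Real.pi)⁻¹ • w.1.2)) : Circle) : ℂ) :=
    continuous_subtype_val.comp (Real.continuous_fourierChar.comp (by fun_prop))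
  exact h3.stronglyMeasurable.mul (h2.stronglyMeasurable.mul h1)

/-- The squared windowed Fourier transform, an unnormalised Husimi function. -/
def husimi (ψ : ModeSpace m) (z : ConfigSpace m × ConfigSpace m) : ℝ :=
  ‖𝓕 (windowed ψ z.1) ((2 * Real.pi)⁻¹ • z.2)‖ ^ 2

theorem integrable_husimi_snd (ψ : ModeSpace m) (q : ConfigSpace m) :
    Integrable fun p : ConfigSpace m => husimi ψ (q, p) := by
  simp only [husimi]
  exact integrable_norm_fourier_sq (integrable_windowed ψ q) (memLp_windowed ψ q)

theorem integral_husimi_snd (ψ : ModeSpace m) (q : ConfigSpace m) :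
    ∫ p, husimi ψ (q, p) =
      (2 * Real.pi) ^ m * ∫ x, ‖ψ x‖ ^ 2 * ‖vacuumWave m (q - x)‖ ^ 2 := by
  have h := integral_exp_mul_norm_fourier_sq (integrable_windowed ψ q) (memLp_windowed ψ q) 0
  simp only [inner_zero_left, Complex.ofReal_zero, mul_zero, Complex.exp_zero, one_mul, add_zero,
    finrank_euclideanSpace, Fintype.card_fin] at h
  rw [integral_complex_ofReal] at h
  have h2 : ∀ x, inner ℂ (windowed ψ q x) (windowed ψ q x) =
      ((‖ψ x‖ ^ 2 * ‖vacuumWave m (q - x)‖ ^ 2 : ℝ) : ℂ) := by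
    intro x
    rw [inner_self_eq_norm_sq_to_K, windowed, norm_mul, ← neg_sub q x, vacuumWave_neg]
    push_cast
    rw [mul_pow, mul_comm]
    rfl
  simp_rw [h2] at h
  rw [integral_complex_ofReal] at h
  simp only [husimi]
  rw [← Complex.ofReal_inj, h]
  push_cast
  rfl

/-- By Plancherel at lag zero, the integral over momentum is a convolution of the integrable
functions `|ψ|²` and `|vacuum|²`, hence integrable in position. -/
theorem integrable_husimi (ψ : ModeSpace m) : Integrable (husimi ψ) := by
  have hm : StronglyMeasurable (husimi ψ) := (stronglyMeasurable_fourier_windowed ψ).norm.pow 2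
  rw [Measure.volume_eq_prod]
  refine (integrable_prod_iff hm.aestronglyMeasurable).2
    ⟨ae_of_all _ (integrable_husimi_snd ψ), ?_⟩
  have h1 : ∀ q, ∫ p, ‖husimi ψ (q, p)‖ =
      (2 * Real.pi) ^ m * ∫ x, ‖ψ x‖ ^ 2 * ‖vacuumWave m (q - x)‖ ^ 2 := by
    intro q
    rw [← integral_husimi_snd]
    refine integral_congr_ae (ae_of_all _ fun p => ?_)
    exact Real.norm_of_nonneg (sq_nonneg _)
  simp_rw [h1]
  refine Integrable.const_mul ?_ _
  have h3 : Integrable fun x => ‖ψ x‖ ^ 2 :=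
    (memLp_two_iff_integrable_sq_norm (Lp.memLp ψ).1).1 (Lp.memLp ψ)
  have h4 : Integrable fun x => ‖vacuumWave m x‖ ^ 2 :=
    (memLp_two_iff_integrable_sq_norm (memLp_vacuumWave m).1).1 (memLp_vacuumWave m)
  exact (h3.convolution_integrand (ContinuousLinearMap.mul ℝ ℝ) h4).integral_prod_left

/-- The momentum integral gives the autocorrelation of the windowed function at lag `a`. The
position integral is then that of a convolution `F ⋆ K`, so it factors: `K` contributes the
ambiguity function of the vacuum, and `F` that of `ψ`. -/
theorem integral_exp_mul_husimi (ψ : ModeSpace m) (a b : ConfigSpace m) :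
    ∫ z : ConfigSpace m × ConfigSpace m,
        Complex.exp (Complex.I * (inner ℝ b z.1 + inner ℝ a z.2 : ℝ)) * (husimi ψ z : ℂ) =
      (2 * Real.pi) ^ m * (Complex.exp (-((‖a‖ ^ 2 + ‖b‖ ^ 2) / 4 : ℝ)) *
        ∫ x, Complex.exp (Complex.I * (inner ℝ b x + inner ℝ b a / 2 : ℝ)) *
          inner ℂ (ψ x) (ψ (x + a))) := by
  have hint : Integrable fun z : ConfigSpace m × ConfigSpace m =>
      Complex.exp (Complex.I * (inner ℝ b z.1 + inner ℝ a z.2 : ℝ)) * (husimi ψ z : ℂ) := by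
    refine (integrable_husimi ψ).ofReal.bdd_mul (c := 1) ?_ (ae_of_all _ fun z => ?_)
    · exact Continuous.aestronglyMeasurable (by fun_prop)
    · rw [mul_comm, Complex.norm_exp_ofReal_mul_I]
  rw [Measure.volume_eq_prod, integral_prod _ hint]
  let F : ConfigSpace m → ℂ := fun x =>
    Complex.exp (Complex.I * (inner ℝ b x : ℝ)) * inner ℂ (ψ x) (ψ (x + a))
  let K : ConfigSpace m → ℂ := fun y =>
    Complex.exp (Complex.I * (inner ℝ b y : ℝ)) * (vacuumWave m y * vacuumWave m (y - a))
  have hexp : AEStronglyMeasurable (fun x : ConfigSpace m =>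
      Complex.exp (Complex.I * (inner ℝ b x : ℝ))) volume :=
    Continuous.aestronglyMeasurable (by fun_prop)
  have hexp1 : ∀ᵐ x : ConfigSpace m, ‖Complex.exp (Complex.I * (inner ℝ b x : ℝ))‖ ≤ 1 :=
    ae_of_all _ fun x => by rw [mul_comm, Complex.norm_exp_ofReal_mul_I]
  have hF : Integrable F := by
    refine Integrable.bdd_mul ?_ hexp hexp1
    have h1 : MemLp (fun x => ψ (x + a)) 2 (volume : Measure (ConfigSpace m)) :=
      (Lp.memLp ψ).comp_measurePreserving (measurePreserving_add_right volume a)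
    simp only [RCLike.inner_apply]
    exact h1.integrable_mul (Lp.memLp ψ).star
  have hK : Integrable K :=
    ((memLp_vacuumWave m).integrable_mul (memLp_vacuumWave_sub a)).bdd_mul hexp hexp1
  have hinner : ∀ q : ConfigSpace m, (∫ p : ConfigSpace m,
      Complex.exp (Complex.I * (inner ℝ b q + inner ℝ a p : ℝ)) * (husimi ψ (q, p) : ℂ)) =
      (2 * Real.pi) ^ m * ∫ x, ContinuousLinearMap.mul ℂ ℂ (F x) (K (q - x)) := by
    intro q
    have h := integral_exp_mul_norm_fourier_sq (integrable_windowed ψ q) (memLp_windowed ψ q) a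
    rw [finrank_euclideanSpace, Fintype.card_fin] at h
    calc _ = ∫ p : ConfigSpace m, Complex.exp (Complex.I * (inner ℝ b q : ℝ)) *
          (Complex.exp (Complex.I * (inner ℝ a p : ℝ)) *
            ((‖𝓕 (windowed ψ q) ((2 * Real.pi)⁻¹ • p)‖ ^ 2 : ℝ) : ℂ)) := by
          refine integral_congr_ae (ae_of_all _ fun p => ?_)
          simp only [husimi]
          rw [← mul_assoc, ← Complex.exp_add, Complex.ofReal_add, mul_add]
      _ = (2 * Real.pi) ^ m * ∫ x, Complex.exp (Complex.I * (inner ℝ b q : ℝ)) *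
            inner ℂ (windowed ψ q x) (windowed ψ q (x + a)) := by
          rw [integral_const_mul, integral_const_mul, h]
          ring
      _ = _ := by
          congr 1
          refine integral_congr_ae (ae_of_all _ fun x => ?_)
          simp only [ContinuousLinearMap.mul_apply', F, K, windowed, RCLike.inner_apply, map_mul,
            conj_vacuumWave]
          have e1 : vacuumWave m (x - q) = vacuumWave m (q - x) := by
            rw [← neg_sub, vacuumWave_neg]
          have e2 : vacuumWave m (x + a - q) = vacuumWave m (q - x - a) := by
            rw [← vacuumWave_neg]
            congr 1
            abel
          -- Splitting the phase at `q = x + (q - x)` is what exposes the convolution.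
          have e3 : Complex.exp (Complex.I * (inner ℝ b q : ℝ)) =
              Complex.exp (Complex.I * (inner ℝ b x : ℝ)) *
                Complex.exp (Complex.I * (inner ℝ b (q - x) : ℝ)) := by
            rw [← Complex.exp_add, inner_sub_right]
            congr 1
            push_cast
            ring
          rw [e1, e2, e3]
          ring
  simp_rw [hinner]
  rw [integral_const_mul]
  have hconv := integral_convolution (ContinuousLinearMap.mul ℂ ℂ)
    (μ := (volume : Measure (ConfigSpace m))) hF hK
  simp only [convolution] at hconv
  rw [hconv, ContinuousLinearMap.mul_apply']
  have hKval : ∫ y, K y = _ := integral_exp_mul_vacuumWave_mul a b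
  have hFval : ∫ x, Complex.exp (Complex.I * (inner ℝ b x + inner ℝ b a / 2 : ℝ)) *
      inner ℂ (ψ x) (ψ (x + a)) =
      Complex.exp (Complex.I * (inner ℝ b a / 2 : ℝ)) * ∫ x, F x := by
    rw [← integral_const_mul]
    refine integral_congr_ae (ae_of_all _ fun x => ?_)
    simp only [F]
    rw [← mul_assoc, ← Complex.exp_add, Complex.ofReal_add, mul_add, add_comm]
  rw [hKval, hFval]
  ring

end Heterodyne

/-! ### Gaussian marginals of the heterodyne outcomes -/

section HeterodyneLaw

open ProbabilityTheory
open scoped NNReal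

variable {m : ℕ}

/-- The rotated vector `J t`, indexing the displacement that generates the `t`-marginal. -/
def rotate (t : PhaseSpace m) : PhaseSpace m := WithLp.toLp 2 (Matrix.J (Fin m) ℝ *ᵥ t.ofLp)

theorem positionPart_rotate (t : PhaseSpace m) : positionPart (rotate t) = -momentumPart t := by
  ext j
  simp [rotate, positionPart, momentumPart, Matrix.J, Matrix.mulVec, dotProduct, Matrix.one_apply]

theorem momentumPart_rotate (t : PhaseSpace m) : momentumPart (rotate t) = positionPart t := by
  ext j
  simp [rotate, positionPart, momentumPart, Matrix.J, Matrix.mulVec, dotProduct, Matrix.one_apply]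

theorem norm_rotate (t : PhaseSpace m) : ‖rotate t‖ = ‖t‖ := by
  rw [← sq_eq_sq₀ (norm_nonneg _) (norm_nonneg _), norm_sq_phaseSpace, norm_sq_phaseSpace t,
    positionPart_rotate, momentumPart_rotate, norm_neg, add_comm]

theorem symplecticPhase_rotate (t r : PhaseSpace m) :
    symplecticPhase (rotate t) r = inner ℝ t r := by
  rw [symplecticPhase, positionPart_rotate, momentumPart_rotate, inner_phaseSpace, inner_neg_left,
    sub_neg_eq_add]

theorem norm_inner_coherentState_sq (ψ : ModeSpace m) (ξ : PhaseSpace m) :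
    ‖inner ℂ (coherentState ξ) ψ‖ ^ 2 = husimi ψ (phaseSpaceEquivProd m ξ) := by
  rw [norm_inner_coherentState, phaseSpaceEquivProd_apply]
  rfl

theorem integrable_norm_inner_coherentState_sq (ψ : ModeSpace m) :
    Integrable fun ξ : PhaseSpace m => ‖inner ℂ (coherentState ξ) ψ‖ ^ 2 := by
  simp only [norm_inner_coherentState_sq]
  exact (measurePreserving_phaseSpaceEquivProd m).integrable_comp_of_integrable
    (integrable_husimi ψ)

theorem measurable_norm_inner_coherentState_sq (ψ : ModeSpace m) :
    Measurable fun ξ : PhaseSpace m => ‖inner ℂ (coherentState ξ) ψ‖ ^ 2 := by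
  simp only [norm_inner_coherentState_sq]
  have h : Measurable (husimi ψ) := ((stronglyMeasurable_fourier_windowed ψ).norm.pow 2).measurable
  exact h.comp (phaseSpaceEquivProd m).measurable

theorem integral_exp_inner_mul_norm_inner_coherentState_sq (ψ : ModeSpace m) (t : PhaseSpace m) :
    ∫ ξ : PhaseSpace m, Complex.exp (inner ℝ ξ t * Complex.I) *
        ((((2 * Real.pi) ^ m)⁻¹ * ‖inner ℂ (coherentState ξ) ψ‖ ^ 2 : ℝ) : ℂ) =
      Complex.exp (-(‖t‖ ^ 2 / 4 : ℝ)) * inner ℂ ψ (displacement (rotate t) ψ) := by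
  have h := integral_exp_mul_husimi ψ (momentumPart t) (positionPart t)
  rw [← (measurePreserving_phaseSpaceEquivProd m).integral_comp'] at h
  have hpi : ((2 * Real.pi : ℂ)) ^ m ≠ 0 := by
    simp [Real.pi_ne_zero]
  calc _ = ((2 * Real.pi : ℂ) ^ m)⁻¹ * ∫ ξ : PhaseSpace m,
        Complex.exp (Complex.I * (inner ℝ (positionPart t) (phaseSpaceEquivProd m ξ).1 +
          inner ℝ (momentumPart t) (phaseSpaceEquivProd m ξ).2 : ℝ)) *
          (husimi ψ (phaseSpaceEquivProd m ξ) : ℂ) := by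
        rw [← integral_const_mul]
        refine integral_congr_ae (ae_of_all _ fun ξ => ?_)
        simp only [norm_inner_coherentState_sq]
        simp only [phaseSpaceEquivProd_apply]
        rw [real_inner_comm, inner_phaseSpace, mul_comm _ Complex.I]
        push_cast
        ring
    _ = _ := by
        rw [h, ← mul_assoc, inv_mul_cancel₀ hpi, one_mul, norm_sq_phaseSpace, add_comm]
        congr 1
        rw [L2.inner_def]
        refine integral_congr_ae ?_
        filter_upwards [coeFn_displacement (rotate t) ψ] with x hx
        rw [hx, displacedWave, positionPart_rotate, momentumPart_rotate, sub_neg_eq_add,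
          inner_neg_right, RCLike.inner_apply, RCLike.inner_apply, mul_assoc]
        congr 3
        push_cast
        ring

/-- Valid for every pure state: the Gaussian factor is the noise added by the measurement, and the
inner product is the characteristic function of the state itself. -/
theorem charFun_heterodyneLaw (ψ : ModeSpace m) (t : PhaseSpace m) :
    charFun (heterodyneLaw ψ) t =
      Complex.exp (-(‖t‖ ^ 2 / 4 : ℝ)) * inner ℂ ψ (displacement (rotate t) ψ) := by
  rw [charFun_apply, heterodyneLaw, integral_withDensity_eq_integral_toReal_smul
    ((measurable_norm_inner_coherentState_sq ψ).const_mul _).ennreal_ofReal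
    (ae_of_all _ fun _ => ENNReal.ofReal_lt_top),
    ← integral_exp_inner_mul_norm_inner_coherentState_sq]
  refine integral_congr_ae (ae_of_all _ fun ξ => ?_)
  simp only
  rw [ENNReal.toReal_ofReal (by positivity), Complex.real_smul, mul_comm]

instance isFiniteMeasure_heterodyneLaw (ψ : ModeSpace m) : IsFiniteMeasure (heterodyneLaw ψ) :=
  isFiniteMeasure_withDensity_ofReal
    ((integrable_norm_inner_coherentState_sq ψ).const_mul _).2

/-- Since `S J Sᵀ = J`, the displacement by `J t` is the displacement by `J Sᵀ t` transported
through `U_S`. Moving it past the displacements by `r` and `s` yields the phases `⟨t, r⟩` and `⟨Sᵀ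
t, s⟩ = ⟨t, S s⟩`, and the vacuum expectation remains. -/
theorem inner_gaussianUnitary_displacement {r : PhaseSpace m} {S : QuadMatrix m}
    (hS : S ∈ Matrix.symplecticGroup (Fin m) ℝ) {G : ModeSpace m ≃ₗᵢ[ℂ] ModeSpace m}
    (hG : IsGaussianUnitary r S G) (s t : PhaseSpace m) :
    inner ℂ (G (coherentState s)) (displacement (rotate t) (G (coherentState s))) =
      Complex.exp (Complex.I *
        (inner ℝ t (r + Matrix.toEuclideanCLM (𝕜 := ℝ) S s) : ℝ)) *
        Complex.exp (-(‖Matrix.toEuclideanCLM (𝕜 := ℝ) Sᵀ t‖ ^ 2 / 4 : ℝ)) := by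
  obtain ⟨U, hU, hGU⟩ := hG
  set v := Matrix.toEuclideanCLM (𝕜 := ℝ) Sᵀ t with hv
  have hSv : rotate t = WithLp.toLp 2 (S *ᵥ (rotate v).ofLp) := by
    have h := SymplecticGroup.mem_iff.1 hS
    simp only [rotate, hv, Matrix.ofLp_toEuclideanCLM, Matrix.mulVec_mulVec]
    rw [← mul_assoc, h]
  rw [hGU, inner_displacement_conj, symplecticPhase_rotate, hSv, ← hU,
    LinearIsometryEquiv.inner_map_map, coherentState, inner_displacement_conj,
    symplecticPhase_rotate, inner_vacuum_displacement, norm_rotate, ← mul_assoc, ← Complex.exp_add,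
    inner_add_right]
  have hadj : inner ℝ v s = inner ℝ t (Matrix.toEuclideanCLM (𝕜 := ℝ) S s) := by
    rw [hv, real_inner_comm, Matrix.inner_toEuclideanCLM, Matrix.inner_toEuclideanCLM,
      Matrix.mulVec_transpose, dotProduct_comm, ← Matrix.dotProduct_mulVec]
  rw [hadj, Complex.ofReal_add, mul_add]

/-- The heterodyne outcomes of a Gaussian unitary acting on a coherent state have Gaussian
one-dimensional marginals, with mean `r + S s` and covariance `(S Sᵀ + 1) / 2`. -/
theorem map_heterodyneLaw_gaussianUnitary {r : PhaseSpace m} {S : QuadMatrix m}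
    (hS : S ∈ Matrix.symplecticGroup (Fin m) ℝ) {G : ModeSpace m ≃ₗᵢ[ℂ] ModeSpace m}
    (hG : IsGaussianUnitary r S G) (s t : PhaseSpace m) :
    (heterodyneLaw (G (coherentState s))).map
      (fun ξ => inner ℝ t (ξ - (r + Matrix.toEuclideanCLM (𝕜 := ℝ) S s))) =
      gaussianReal 0 ((‖t‖₊ ^ 2 + ‖Matrix.toEuclideanCLM (𝕜 := ℝ) Sᵀ t‖₊ ^ 2) / 2) := by
  refine Measure.ext_of_charFun (funext fun u => ?_)
  rw [charFun_gaussianReal, charFun_apply_real, integral_map (by fun_prop) (by fun_prop)]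
  set μ := r + Matrix.toEuclideanCLM (𝕜 := ℝ) S s with hμ
  have h := charFun_heterodyneLaw (G (coherentState s)) (u • t)
  rw [inner_gaussianUnitary_displacement hS hG, charFun_apply] at h
  calc _ = ∫ ξ, Complex.exp (-(Complex.I * (inner ℝ (u • t) μ : ℝ))) *
        Complex.exp (inner ℝ ξ (u • t) * Complex.I) ∂heterodyneLaw (G (coherentState s)) := by
        refine integral_congr_ae (ae_of_all _ fun ξ => ?_)
        simp only
        rw [← Complex.exp_add, inner_sub_right, real_inner_comm, inner_smul_left, inner_smul_right]
        congr 1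
        push_cast
        simp
        ring
    _ = _ := by
        rw [integral_const_mul, h, ← hμ]
        simp only [← Complex.exp_add]
        congr 1
        rw [map_smul, norm_smul, norm_smul, mul_pow, mul_pow, Real.norm_eq_abs, sq_abs]
        push_cast
        simp
        ring

/-- Total mass survives a pushforward, and the marginal at `t = 0` is already known to be a Gaussian
probability measure. -/
theorem isProbabilityMeasure_heterodyneLaw_gaussianUnitary {r : PhaseSpace m} {S : QuadMatrix m}
    (hS : S ∈ Matrix.symplecticGroup (Fin m) ℝ) {G : ModeSpace m ≃ₗᵢ[ℂ] ModeSpace m}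
    (hG : IsGaussianUnitary r S G) (s : PhaseSpace m) :
    IsProbabilityMeasure (heterodyneLaw (G (coherentState s))) := by
  have h := map_heterodyneLaw_gaussianUnitary hS hG s 0
  refine ⟨?_⟩
  have h1 := congrArg (fun ν : Measure ℝ => ν Set.univ) h
  simp only [measure_univ (μ := gaussianReal _ _)] at h1
  rwa [Measure.map_apply (by fun_prop) MeasurableSet.univ, Set.preimage_univ] at h1

/-- The variance `(‖t‖² + ‖Sᵀ t‖²) / 2` is at most `z² ‖t‖²`; the measurement noise is absorbed
thanks to `1 ≤ z`. -/
theorem hasSubgaussianMGF_heterodyneLaw {r : PhaseSpace m} {S : QuadMatrix m}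
    (hS : S ∈ Matrix.symplecticGroup (Fin m) ℝ) {G : ModeSpace m ≃ₗᵢ[ℂ] ModeSpace m}
    (hG : IsGaussianUnitary r S G) {z : ℝ≥0} (hz : ‖S‖ ≤ z) (hz1 : 1 ≤ z) (s t : PhaseSpace m) :
    HasSubgaussianMGF
      (fun ξ => inner ℝ t (ξ - (r + Matrix.toEuclideanCLM (𝕜 := ℝ) S s)))
      (z ^ 2 * ‖t‖₊ ^ 2) (heterodyneLaw (G (coherentState s))) := by
  refine HasSubgaussianMGF.of_map (X := id) (by fun_prop) ?_
  rw [map_heterodyneLaw_gaussianUnitary hS hG]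
  refine ⟨fun u => integrable_exp_mul_gaussianReal u, fun u => ?_⟩
  rw [mgf_id_gaussianReal]
  simp only [zero_mul, zero_add]
  refine Real.exp_le_exp.2 ?_
  have h1 : ‖Matrix.toEuclideanCLM (𝕜 := ℝ) Sᵀ t‖ ≤ z * ‖t‖ := by
    refine (ContinuousLinearMap.le_opNorm _ _).trans (mul_le_mul_of_nonneg_right ?_ (norm_nonneg _))
    rw [← Matrix.cstar_norm_def, norm_transpose]
    exact hz
  have h2 := pow_le_pow_left₀ (norm_nonneg _) h1 2
  have h3 : (1 : ℝ) ≤ (z : ℝ) ^ 2 := one_le_pow₀ (by exact_mod_cast hz1)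
  push_cast
  refine div_le_div_of_nonneg_right (mul_le_mul_of_nonneg_right ?_ (sq_nonneg u)) (by norm_num)
  nlinarith [sq_nonneg ‖t‖]

end HeterodyneLaw

/-! # Linear estimators -/

section Protocol

open ProbabilityTheory
open scoped NNReal

variable {m : ℕ}

theorem ProbabilityTheory.HasSubgaussianMGF.mono_parameter {Ω : Type*} [MeasurableSpace Ω]
    {μ : Measure Ω} {X : Ω → ℝ} {c d : ℝ≥0} (h : HasSubgaussianMGF X c μ) (hcd : c ≤ d) :
    HasSubgaussianMGF X d μ :=
  ⟨h.integrable_exp_mul, fun t => (h.mgf_le t).trans (Real.exp_le_exp.2 (by gcongr))⟩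

theorem isProbabilityMeasure_outcomeLaw {r : PhaseSpace m} {S : QuadMatrix m}
    (hS : S ∈ Matrix.symplecticGroup (Fin m) ℝ) {G : ModeSpace m ≃ₗᵢ[ℂ] ModeSpace m}
    (hG : IsGaussianUnitary r S G) (P : CoherentProtocol m) :
    IsProbabilityMeasure (P.outcomeLaw G) := by
  have := fun s => isProbabilityMeasure_heterodyneLaw_gaussianUnitary hS hG (P.probe s)
  unfold CoherentProtocol.outcomeLaw
  infer_instance

/-- The deviation of the outcome of shot `s` from its mean. -/
def CoherentProtocol.noise (P : CoherentProtocol m) (r : PhaseSpace m) (S : QuadMatrix m)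
    (y : P.Shot → PhaseSpace m) (s : P.Shot) : PhaseSpace m :=
  y s - (r + Matrix.toEuclideanCLM (𝕜 := ℝ) S (P.probe s))

/-- Independence of the shots makes subgaussian parameters add, so only the sum of squared weights
matters. -/
theorem hasSubgaussianMGF_inner_sum_noise {r : PhaseSpace m} {S : QuadMatrix m}
    (hS : S ∈ Matrix.symplecticGroup (Fin m) ℝ) {G : ModeSpace m ≃ₗᵢ[ℂ] ModeSpace m}
    (hG : IsGaussianUnitary r S G) {z : ℝ≥0} (hz : ‖S‖ ≤ z) (hz1 : 1 ≤ z)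
    (P : CoherentProtocol m) (w : P.Shot → ℝ) {c : ℝ≥0}
    (hc : (z : ℝ) ^ 2 * ∑ s, w s ^ 2 ≤ c) (t : PhaseSpace m) :
    HasSubgaussianMGF (fun y => inner ℝ t (∑ s, w s • P.noise r S y s)) (c * ‖t‖₊ ^ 2)
      (P.outcomeLaw G) := by
  have := fun s => isProbabilityMeasure_heterodyneLaw_gaussianUnitary hS hG (P.probe s)
  have hind : iIndepFun (fun s (y : P.Shot → PhaseSpace m) => inner ℝ (w s • t) (P.noise r S y s))
      (P.outcomeLaw G) :=
    iIndepFun_pi (μ := fun s => heterodyneLaw (G (coherentState (P.probe s))))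
      (X := fun s ξ => inner ℝ (w s • t) (ξ - (r + Matrix.toEuclideanCLM (𝕜 := ℝ) S (P.probe s))))
      fun s => by fun_prop
  have hsub : ∀ s ∈ (Finset.univ : Finset P.Shot), HasSubgaussianMGF
      (fun y : P.Shot → PhaseSpace m => inner ℝ (w s • t) (P.noise r S y s))
      (z ^ 2 * ‖w s • t‖₊ ^ 2) (P.outcomeLaw G) := by
    intro s _
    have h := hasSubgaussianMGF_heterodyneLaw hS hG hz hz1 (P.probe s) (w s • t)
    have hmp := measurePreserving_eval
      (fun s => heterodyneLaw (G (coherentState (P.probe s)))) s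
    rw [← hmp.map_eq] at h
    exact HasSubgaussianMGF.of_map (μ := P.outcomeLaw G)
      (Y := fun y : P.Shot → PhaseSpace m => y s) hmp.measurable.aemeasurable h
  have h := (HasSubgaussianMGF.sum_of_iIndepFun hind hsub).mono_parameter (d := c * ‖t‖₊ ^ 2) ?_
  · refine h.congr (ae_of_all _ fun y => ?_)
    simp only [inner_sum, inner_smul_left, inner_smul_right]
    rfl
  · rw [← NNReal.coe_le_coe]
    push_cast
    calc ∑ s, (z : ℝ) ^ 2 * ‖w s • t‖ ^ 2 = ((z : ℝ) ^ 2 * ∑ s, w s ^ 2) * ‖t‖ ^ 2 := by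
          rw [Finset.mul_sum, Finset.sum_mul]
          refine Finset.sum_congr rfl fun s _ => ?_
          rw [norm_smul, mul_pow, Real.norm_eq_abs, sq_abs, mul_assoc]
      _ ≤ _ := mul_le_mul_of_nonneg_right hc (sq_nonneg _)

/-- The `i`-th column of the estimate is the linear statistic with weights `a i`, which are
calibrated to the probes. -/
structure CoherentProtocol.IsLinear (P : CoherentProtocol m) (a : Quad m → P.Shot → ℝ) : Prop where
  estimate_eq : ∀ y, P.estimate y = ofColumns fun i => ∑ s, a i s • y s
  sum_eq_zero : ∀ i, ∑ s, a i s = 0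
  sum_smul_probe : ∀ i, ∑ s, a i s • P.probe s = EuclideanSpace.single i 1

/-- Weights summing to zero remove the unknown `r`, and calibration on the probes reproduces `S e_i`
exactly; the error is pure noise. -/
theorem CoherentProtocol.IsLinear.col_sub {P : CoherentProtocol m} {a : Quad m → P.Shot → ℝ}
    (ha : P.IsLinear a) (r : PhaseSpace m) (S : QuadMatrix m) (y : P.Shot → PhaseSpace m)
    (i : Quad m) :
    WithLp.toLp 2 ((P.estimate y - S).col i) = ∑ s, a i s • P.noise r S y s := by
  have h1 : ∑ s, a i s • P.noise r S y s =
      ∑ s, a i s • y s - Matrix.toEuclideanCLM (𝕜 := ℝ) S (EuclideanSpace.single i 1) := by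
    simp only [CoherentProtocol.noise, smul_sub, smul_add, Finset.sum_sub_distrib,
      Finset.sum_add_distrib, ← Finset.sum_smul, ha.sum_eq_zero, zero_smul, zero_add]
    rw [← ha.sum_smul_probe i, map_sum]
    simp only [map_smul]
  rw [h1, ha.estimate_eq]
  ext j
  simp [ofColumns, Matrix.col_apply]

theorem CoherentProtocol.IsLinear.toEuclideanCLM_sub {P : CoherentProtocol m}
    {a : Quad m → P.Shot → ℝ} (ha : P.IsLinear a) (r : PhaseSpace m) (S : QuadMatrix m)
    (y : P.Shot → PhaseSpace m) (v : PhaseSpace m) :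
    Matrix.toEuclideanCLM (𝕜 := ℝ) (P.estimate y - S) v =
      ∑ s, (∑ i, v i * a i s) • P.noise r S y s := by
  rw [Matrix.toEuclideanCLM_apply_eq_sum]
  simp only [ha.col_sub r, Finset.smul_sum, Finset.sum_smul, mul_smul]
  exact Finset.sum_comm

theorem CoherentProtocol.IsLinear.measurable_sub {P : CoherentProtocol m}
    {a : Quad m → P.Shot → ℝ} (ha : P.IsLinear a) (S : QuadMatrix m) (i j : Quad m) :
    Measurable fun y : P.Shot → PhaseSpace m => (P.estimate y - S) i j := by
  simp only [ha.estimate_eq, Matrix.sub_apply, ofColumns, Matrix.of_apply, WithLp.ofLp_sum,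
    Finset.sum_apply, PiLp.smul_apply]
  fun_prop

theorem mem_successEvent {S : QuadMatrix m} (hS : S ∈ Matrix.symplecticGroup (Fin m) ℝ) {z τ : ℝ}
    (hz : ‖S‖ ≤ z) (hz1 : 1 ≤ z) (hτ0 : 0 < τ) (hτ1 : τ < 1) {P : CoherentProtocol m}
    {y : P.Shot → PhaseSpace m} (hy : ‖P.estimate y - S‖ ≤ τ / (4 * z ^ 2)) :
    y ∈ P.successEvent S τ := by
  obtain ⟨h1, h2⟩ := isRegularizable_and_norm_sub_le hS hz hz1 hτ0 hτ1 hy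
  exact ⟨h1, symplecticRegularization_mem h1, h2⟩

/-- Subadditivity alone suffices, so the success event, which involves a chosen square root, need
not be shown measurable. -/
theorem one_sub_le_measureReal_of_failure_le {Ω : Type*} [MeasurableSpace Ω] {μ : Measure Ω}
    [IsProbabilityMeasure μ] {s t : Set Ω} {δ : ℝ} (hδ : 0 ≤ δ) (hst : tᶜ ⊆ s)
    (ht : μ t ≤ ENNReal.ofReal δ) : 1 - δ ≤ μ.real s := by
  have h1 : μ.real Set.univ ≤ μ.real s + μ.real t :=
    (measureReal_mono (by rw [← Set.compl_subset_iff_union.1 hst, Set.union_comm])).trans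
      (measureReal_union_le s t)
  have h2 : μ.real t ≤ δ := ENNReal.toReal_le_of_le_ofReal hδ ht
  rw [probReal_univ] at h1
  linarith

theorem successEvent_of_isEmpty {S : QuadMatrix 0} (hS : S ∈ Matrix.symplecticGroup (Fin 0) ℝ)
    {τ : ℝ} (hτ0 : 0 < τ) (hτ1 : τ < 1) (P : CoherentProtocol 0) :
    P.successEvent S τ = Set.univ := by
  have h0 : ∀ M : QuadMatrix 0, ‖M‖ = 0 := fun M => by rw [Subsingleton.elim M 0, norm_zero]
  refine Set.eq_univ_of_forall fun y => mem_successEvent hS (z := 1) ?_ le_rfl hτ0 hτ1 ?_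
  · rw [h0]; exact zero_le_one
  · rw [h0]; positivity

theorem one_sub_le_successEvent_of_columns {r : PhaseSpace m} {S : QuadMatrix m}
    (hS : S ∈ Matrix.symplecticGroup (Fin m) ℝ) {G : ModeSpace m ≃ₗᵢ[ℂ] ModeSpace m}
    (hG : IsGaussianUnitary r S G) {z : ℝ≥0} (hz : ‖S‖ ≤ z) (hz1 : 1 ≤ z) {τ δ : ℝ} (hτ0 : 0 < τ)
    (hτ1 : τ < 1) (hδ : 0 < δ) (hm : 0 < m) {P : CoherentProtocol m} {a : Quad m → P.Shot → ℝ}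
    (ha : P.IsLinear a) {c : ℝ≥0} (hc0 : 0 < c)
    (hc : ∀ i, (z : ℝ) ^ 2 * ∑ s, a i s ^ 2 ≤ c)
    (hτ : m + Real.log (2 * m / δ) ≤ τ ^ 2 / (128 * m * z ^ 4 * c)) :
    1 - δ ≤ (P.outcomeLaw G).real (P.successEvent S τ) := by
  have := isProbabilityMeasure_outcomeLaw hS hG P
  have hm' : (0 : ℝ) < m := by exact_mod_cast hm
  have hz' : (0 : ℝ) < z := zero_lt_one.trans_le (by exact_mod_cast hz1)
  have hc' : (0 : ℝ) < c := hc0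
  have hcard : (Fintype.card (Quad m) : ℝ) = 2 * m := by simp; ring
  have h := measure_norm_matrix_gt_le_of_columns (μ := P.outcomeLaw G)
    (E := fun y => P.estimate y - S) (ha.measurable_sub S) hc0
    (fun i t => by
      simp only [ha.col_sub r]
      exact hasSubgaussianMGF_inner_sum_noise hS hG hz hz1 P (a i) (hc i) t)
    (R := τ / (4 * z ^ 2) / √(2 * m)) (by positivity)
  rw [hcard, mul_div_cancel₀ _ (by positivity)] at h
  refine one_sub_le_measureReal_of_failure_le hδ.le (fun y hy => ?_)
    (h.trans (ENNReal.ofReal_le_ofReal ?_))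
  · exact mem_successEvent hS hz (by exact_mod_cast hz1) hτ0 hτ1 (not_lt.1 hy)
  · have e : (τ / (4 * (z : ℝ) ^ 2) / √(2 * m)) ^ 2 / (4 * c) = τ ^ 2 / (128 * m * z ^ 4 * c) := by
      rw [div_pow, Real.sq_sqrt (by positivity)]
      field_simp
      ring
    rw [e, show (2 * (m : ℝ)) / 2 = m by ring]
    -- The dimensional factor of the vector tail bound is paid for by the summand `m` in `hτ`; the
    -- `2 * m` inside the logarithm pays for the union over columns.
    have h1 : (2 : ℝ) ^ (m : ℝ) ≤ Real.exp m := by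
      rw [← Real.exp_one_rpow]
      exact Real.rpow_le_rpow zero_le_two (by have := Real.exp_one_gt_d9; linarith) hm'.le
    calc 2 * (m : ℝ) * (2 ^ (m : ℝ) * Real.exp (-(τ ^ 2 / (128 * m * z ^ 4 * c))))
        ≤ 2 * (m : ℝ) * (Real.exp m * Real.exp (-(m + Real.log (2 * m / δ)))) := by gcongr
      _ = 2 * (m : ℝ) * Real.exp (-Real.log (2 * m / δ)) := by
          rw [← Real.exp_add]
          congr 2
          ring
      _ = δ := by
          rw [Real.exp_neg, Real.exp_log (by positivity)]
          field_simp

theorem one_sub_le_successEvent_of_matrix {r : PhaseSpace m} {S : QuadMatrix m}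
    (hS : S ∈ Matrix.symplecticGroup (Fin m) ℝ) {G : ModeSpace m ≃ₗᵢ[ℂ] ModeSpace m}
    (hG : IsGaussianUnitary r S G) {z : ℝ≥0} (hz : ‖S‖ ≤ z) (hz1 : 1 ≤ z) {τ δ : ℝ} (hτ0 : 0 < τ)
    (hτ1 : τ < 1) (hδ : 0 < δ) {P : CoherentProtocol m} {a : Quad m → P.Shot → ℝ}
    (ha : P.IsLinear a) {c : ℝ≥0} (hc0 : 0 < c)
    (hc : ∀ v : PhaseSpace m, ‖v‖ ≤ 1 → (z : ℝ) ^ 2 * ∑ s, (∑ i, v i * a i s) ^ 2 ≤ c)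
    (hτ : 5 * m + Real.log (1 / δ) ≤ 9 * τ ^ 2 / (1024 * z ^ 4 * c)) :
    1 - δ ≤ (P.outcomeLaw G).real (P.successEvent S τ) := by
  have := isProbabilityMeasure_outcomeLaw hS hG P
  have hz' : (0 : ℝ) < z := zero_lt_one.trans_le (by exact_mod_cast hz1)
  have hc' : (0 : ℝ) < c := hc0
  have hcard : Fintype.card (Quad m) = 2 * m := by simp; ring
  have h := measure_norm_matrix_ge_le (μ := P.outcomeLaw G)
    (E := fun y => P.estimate y - S) (ha.measurable_sub S) hc0
    (fun v hv t => by
      simp only [ha.toEuclideanCLM_sub r]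
      exact hasSubgaussianMGF_inner_sum_noise hS hG hz hz1 P _ (hc v hv) t)
    (K := τ / (4 * z ^ 2)) (by positivity)
  rw [hcard] at h
  refine one_sub_le_measureReal_of_failure_le hδ.le (fun y hy => ?_)
    (h.trans (ENNReal.ofReal_le_ofReal ?_))
  · exact mem_successEvent hS hz (by exact_mod_cast hz1) hτ0 hτ1 (lt_of_not_ge fun h => hy h).le
  · have e : (3 / 4 * (τ / (4 * (z : ℝ) ^ 2))) ^ 2 / (4 * c) = 9 * τ ^ 2 / (1024 * z ^ 4 * c) := by
      field_simp
      ring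
    -- The factor is `(64 * 2) ^ m = 128 ^ m`, and `128 < 2.7 ^ 5 < e ^ 5` explains the `5 * m` in
    -- `hτ`.
    have h1 : (8 : ℝ) ^ (2 * m) * 2 ^ (((2 * m : ℕ) : ℝ) / 2) ≤ Real.exp (5 * m) := by
      rw [show ((2 * m : ℕ) : ℝ) / 2 = m by push_cast; ring, Real.rpow_natCast, pow_mul, ← mul_pow,
        mul_comm (5 : ℝ), Real.exp_nat_mul]
      refine pow_le_pow_left₀ (by norm_num) ?_ m
      have h2 : Real.exp 5 = Real.exp 1 ^ 5 := by rw [← Real.exp_nat_mul]; norm_num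
      have h3 : (2.7 : ℝ) ^ 5 ≤ Real.exp 1 ^ 5 :=
        pow_le_pow_left₀ (by norm_num) (by have := Real.exp_one_gt_d9; linarith) 5
      rw [h2]
      norm_num at h3 ⊢
      linarith
    rw [e, ← mul_assoc]
    calc (8 : ℝ) ^ (2 * m) * 2 ^ (((2 * m : ℕ) : ℝ) / 2) *
          Real.exp (-(9 * τ ^ 2 / (1024 * z ^ 4 * c)))
        ≤ Real.exp (5 * m) * Real.exp (-(5 * m + Real.log (1 / δ))) := by gcongr
      _ = δ := by
          rw [← Real.exp_add, one_div, Real.log_inv, ← sub_eq_add_neg, sub_add_cancel_left, neg_neg,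
            Real.exp_log hδ]

end Protocol

/-! # The vacuum-shared and symmetric-probe schemes -/

section Schemes

open scoped NNReal

variable {m : ℕ}

/-- The weights of the vacuum-shared estimate. -/
def vacuumSharedWeight (m : ℕ) (η : ℝ) (N : ℕ) (i : Quad m) (s : Option (Quad m) × Fin N) : ℝ :=
  (η * N)⁻¹ * s.1.elim (-1) fun j => if j = i then 1 else 0

theorem isLinear_vacuumSharedProtocol {η : ℝ} (hη : 0 < η) {N : ℕ} (hN : 0 < N) :
    (vacuumSharedProtocol m η N).IsLinear (vacuumSharedWeight m η N) := by
  have hN' : (N : ℝ) ≠ 0 := by positivity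
  refine ⟨fun y => ?_, fun i => ?_, fun i => ?_⟩
  · show ofColumns _ = ofColumns _
    congr 1
    funext i
    show _ = ∑ s : Option (Quad m) × Fin N, vacuumSharedWeight m η N i s • y s
    rw [Fintype.sum_prod_type, Fintype.sum_option]
    simp only [vacuumSharedWeight, Option.elim_none, Option.elim_some, mul_ite, mul_one, mul_zero,
      ite_smul, zero_smul, ← Finset.smul_sum, Finset.sum_ite_irrel, Finset.sum_const_zero,
      Finset.sum_ite_eq', Finset.mem_univ, if_true, empiricalMean, mul_inv, smul_sub, smul_smul,
      mul_neg, neg_smul, Finset.sum_neg_distrib]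
    abel
  · show ∑ s : Option (Quad m) × Fin N, vacuumSharedWeight m η N i s = 0
    rw [Fintype.sum_prod_type, Fintype.sum_option]
    simp [vacuumSharedWeight]
  · show ∑ s : Option (Quad m) × Fin N, vacuumSharedWeight m η N i s •
      s.1.elim (0 : PhaseSpace m) (fun i => EuclideanSpace.single i η) = _
    rw [Fintype.sum_prod_type, Fintype.sum_option]
    simp only [vacuumSharedWeight, Option.elim_none, Option.elim_some, mul_ite, mul_one, mul_zero,
      ite_smul, zero_smul, smul_zero, Finset.sum_const_zero, zero_add, Finset.sum_ite_irrel,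
      Finset.sum_ite_eq', Finset.mem_univ, if_true, Finset.sum_const, Finset.card_univ,
      Fintype.card_fin, ← Nat.cast_smul_eq_nsmul ℝ, smul_smul]
    ext k
    simp only [PiLp.smul_apply, PiLp.single_apply, smul_eq_mul]
    split_ifs
    · field_simp
    · simp

theorem sum_vacuumSharedWeight_sq {η : ℝ} (hη : 0 < η) {N : ℕ} (hN : 0 < N) (i : Quad m) :
    ∑ s, vacuumSharedWeight m η N i s ^ 2 = 2 / (N * η ^ 2) := by
  have hN' : (N : ℝ) ≠ 0 := by positivity
  rw [Fintype.sum_prod_type, Fintype.sum_option]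
  simp only [vacuumSharedWeight, Option.elim_none, Option.elim_some, mul_ite, mul_one, mul_zero,
    ite_pow, Finset.sum_ite_irrel, Finset.sum_const, Finset.card_univ, Fintype.card_fin,
    nsmul_eq_mul, zero_pow two_ne_zero, Finset.sum_ite_eq', Finset.mem_univ, if_true]
  field_simp
  norm_num

/-- The weights of the symmetric-probe estimate. -/
def symmetricProbeWeight (m : ℕ) (η : ℝ) (N : ℕ) (i : Quad m) (s : (Quad m × Bool) × Fin N) : ℝ :=
  (2 * η * N)⁻¹ * if s.1.1 = i then (if s.1.2 then 1 else -1) else 0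

theorem isLinear_symmetricProbeProtocol {η : ℝ} (hη : 0 < η) {N : ℕ} (hN : 0 < N) :
    (symmetricProbeProtocol m η N).IsLinear (symmetricProbeWeight m η N) := by
  have hN' : (N : ℝ) ≠ 0 := by positivity
  refine ⟨fun y => ?_, fun i => ?_, fun i => ?_⟩
  · show ofColumns _ = ofColumns _
    congr 1
    funext i
    show _ = ∑ s : (Quad m × Bool) × Fin N, symmetricProbeWeight m η N i s • y s
    rw [Fintype.sum_prod_type, Fintype.sum_prod_type]
    simp only [symmetricProbeWeight, Fintype.sum_bool, mul_ite, mul_one, mul_zero, if_true,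
      Bool.false_eq_true, if_false, ite_smul, zero_smul, ← Finset.smul_sum, Finset.sum_ite_irrel,
      Finset.sum_const_zero, Finset.sum_ite_eq', Finset.mem_univ,
      empiricalMean, mul_inv, smul_sub, smul_smul,
      mul_neg, neg_smul, Finset.sum_neg_distrib]
    abel
  · show ∑ s : (Quad m × Bool) × Fin N, symmetricProbeWeight m η N i s = 0
    rw [Fintype.sum_prod_type, Fintype.sum_prod_type]
    simp [symmetricProbeWeight]
  · show ∑ s : (Quad m × Bool) × Fin N, symmetricProbeWeight m η N i s •
      (EuclideanSpace.single s.1.1 (if s.1.2 then η else -η) : PhaseSpace m) = _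
    rw [Fintype.sum_prod_type, Fintype.sum_prod_type]
    simp only [symmetricProbeWeight, Fintype.sum_bool, mul_ite, mul_one, mul_zero, if_true,
      Bool.false_eq_true, if_false, ite_smul, zero_smul, Finset.sum_const_zero,
      Finset.sum_ite_irrel, Finset.sum_ite_eq', Finset.mem_univ,
      Finset.sum_const, Finset.card_univ, Fintype.card_fin, ← Nat.cast_smul_eq_nsmul ℝ, smul_smul]
    ext k
    simp only [PiLp.smul_apply, PiLp.add_apply, PiLp.single_apply, smul_eq_mul]
    split_ifs
    · field_simp
      norm_num
    · simp

/-- Distinct columns use disjoint shots, so no cross terms occur and the variance in a direction `v`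
depends only on `‖v‖`, not on the dimension. -/
theorem sum_symmetricProbeWeight_sq {η : ℝ} (hη : 0 < η) {N : ℕ} (hN : 0 < N)
    (v : PhaseSpace m) :
    ∑ s, (∑ i, v i * symmetricProbeWeight m η N i s) ^ 2 = ‖v‖ ^ 2 / (2 * N * η ^ 2) := by
  have hN' : (N : ℝ) ≠ 0 := by positivity
  have h1 : ∀ s : (Quad m × Bool) × Fin N, (∑ i, v i * symmetricProbeWeight m η N i s) ^ 2 =
      ((2 * η * N)⁻¹) ^ 2 * v s.1.1 ^ 2 := by
    intro s
    simp only [symmetricProbeWeight, mul_ite, mul_zero, Finset.sum_ite_eq, Finset.mem_univ, if_true]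
    split_ifs <;> ring
  simp only [h1]
  rw [Fintype.sum_prod_type, Fintype.sum_prod_type, EuclideanSpace.real_norm_sq_eq]
  simp only [Finset.sum_const, Finset.card_univ, Fintype.card_fin, Fintype.card_bool, nsmul_eq_mul,
    ← Finset.mul_sum]
  field_simp
  norm_num

theorem queryCount_vacuumSharedProtocol (η : ℝ) (N : ℕ) :
    (vacuumSharedProtocol m η N).queryCount = (2 * m + 1) * N := by
  show Fintype.card (Option (Quad m) × Fin N) = _
  simp only [Fintype.card_prod, Fintype.card_option, Fintype.card_sum, Fintype.card_fin]
  ring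

theorem queryCount_symmetricProbeProtocol (η : ℝ) (N : ℕ) :
    (symmetricProbeProtocol m η N).queryCount = 4 * m * N := by
  show Fintype.card ((Quad m × Bool) × Fin N) = _
  simp only [Fintype.card_prod, Fintype.card_bool, Fintype.card_sum, Fintype.card_fin]
  ring

theorem one_sub_le_successEvent_vacuumShared {r : PhaseSpace m} {S : QuadMatrix m}
    (hS : S ∈ Matrix.symplecticGroup (Fin m) ℝ) {G : ModeSpace m ≃ₗᵢ[ℂ] ModeSpace m}
    (hG : IsGaussianUnitary r S G) {z : ℝ≥0} (hz : ‖S‖ ≤ z) (hz1 : 1 ≤ z) {η τ δ : ℝ}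
    (hη : 0 < η) (hτ0 : 0 < τ) (hτ1 : τ < 1) (hδ : 0 < δ) (hδ1 : δ < 1) (hm : 0 < m) {N : ℕ}
    (hN : 324 * m * (z : ℝ) ^ 6 * (√(2 * m) + √(2 * Real.log (2 * m / δ))) ^ 2 /
      (η ^ 2 * τ ^ 2) ≤ (N : ℝ)) :
    1 - δ ≤ ((vacuumSharedProtocol m η N).outcomeLaw G).real
      ((vacuumSharedProtocol m η N).successEvent S τ) := by
  have hm' : (1 : ℝ) ≤ m := by exact_mod_cast hm
  have hz' : (0 : ℝ) < z := zero_lt_one.trans_le (by exact_mod_cast hz1)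
  have hlog : 0 ≤ Real.log (2 * m / δ) :=
    Real.log_nonneg (by rw [le_div_iff₀ hδ]; linarith)
  have hL : 2 * m + 2 * Real.log (2 * m / δ) ≤
      (√(2 * m) + √(2 * Real.log (2 * m / δ))) ^ 2 := by
    rw [add_sq, Real.sq_sqrt (by positivity), Real.sq_sqrt (by positivity)]
    have : 0 ≤ 2 * √(2 * (m : ℝ)) * √(2 * Real.log (2 * m / δ)) := by positivity
    linarith
  generalize √(2 * (m : ℝ)) + √(2 * Real.log (2 * m / δ)) = L at hN hL
  have hL0 : 0 < L ^ 2 := by linarith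
  have hN0 : (0 : ℝ) < N := lt_of_lt_of_le (by positivity) hN
  have hNpos : 0 < N := by exact_mod_cast hN0
  obtain ⟨c, hc⟩ : ∃ c : ℝ≥0, (c : ℝ) = z ^ 2 * (2 / (N * η ^ 2)) :=
    ⟨⟨_, by positivity⟩, rfl⟩
  have hc0 : (0 : ℝ) < c := by rw [hc]; positivity
  refine one_sub_le_successEvent_of_columns hS hG hz hz1 hτ0 hτ1 hδ hm
    (isLinear_vacuumSharedProtocol hη hNpos) (c := c) (by exact_mod_cast hc0)
    (fun i => ?_) ?_
  · have h := sum_vacuumSharedWeight_sq hη hNpos i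
    rw [hc, ← h]
    rfl
  · rw [div_le_iff₀ (by positivity)] at hN
    have e : τ ^ 2 / (128 * m * z ^ 4 * c) = N * (η ^ 2 * τ ^ 2) / (256 * m * z ^ 6) := by
      rw [hc]
      field_simp
      norm_num
    rw [e, le_div_iff₀ (by positivity)]
    refine le_trans ?_ hN
    have hp : (0 : ℝ) < m * z ^ 6 := by positivity
    -- The requirement is `256 (m + log) ≤ 324 L²`, whereas `L² ≥ 2 (m + log)`.
    nlinarith [mul_le_mul_of_nonneg_left hL hp.le]

theorem one_sub_le_successEvent_symmetricProbe {r : PhaseSpace m} {S : QuadMatrix m}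
    (hS : S ∈ Matrix.symplecticGroup (Fin m) ℝ) {G : ModeSpace m ≃ₗᵢ[ℂ] ModeSpace m}
    (hG : IsGaussianUnitary r S G) {z : ℝ≥0} (hz : ‖S‖ ≤ z) (hz1 : 1 ≤ z) {η τ δ : ℝ}
    (hη : 0 < η) (hτ0 : 0 < τ) (hτ1 : τ < 1) (hδ : 0 < δ) (hδ1 : δ < 1) (hm : 0 < m) {N : ℕ}
    (hN : 81 * (z : ℝ) ^ 6 * (2 * √(2 * m) + √(2 * Real.log (1 / δ))) ^ 2 /
      (2 * η ^ 2 * τ ^ 2) ≤ (N : ℝ)) :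
    1 - δ ≤ ((symmetricProbeProtocol m η N).outcomeLaw G).real
      ((symmetricProbeProtocol m η N).successEvent S τ) := by
  have hm' : (1 : ℝ) ≤ m := by exact_mod_cast hm
  have hz' : (0 : ℝ) < z := zero_lt_one.trans_le (by exact_mod_cast hz1)
  have hlog : 0 ≤ Real.log (1 / δ) :=
    Real.log_nonneg (by rw [le_div_iff₀ hδ]; linarith)
  have hL : 8 * m + 2 * Real.log (1 / δ) ≤
      (2 * √(2 * m) + √(2 * Real.log (1 / δ))) ^ 2 := by
    rw [add_sq, mul_pow, Real.sq_sqrt (by positivity), Real.sq_sqrt (by positivity)]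
    have : 0 ≤ 2 * (2 * √(2 * (m : ℝ))) * √(2 * Real.log (1 / δ)) := by positivity
    linarith
  generalize 2 * √(2 * (m : ℝ)) + √(2 * Real.log (1 / δ)) = L at hN hL
  have hL0 : 0 < L ^ 2 := by linarith
  have hN0 : (0 : ℝ) < N := lt_of_lt_of_le (by positivity) hN
  have hNpos : 0 < N := by exact_mod_cast hN0
  obtain ⟨c, hc⟩ : ∃ c : ℝ≥0, (c : ℝ) = z ^ 2 * (1 / (2 * N * η ^ 2)) :=
    ⟨⟨_, by positivity⟩, rfl⟩
  have hc0 : (0 : ℝ) < c := by rw [hc]; positivity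
  refine one_sub_le_successEvent_of_matrix hS hG hz hz1 hτ0 hτ1 hδ
    (isLinear_symmetricProbeProtocol hη hNpos) (c := c) (by exact_mod_cast hc0)
    (fun v hv => ?_) ?_
  · have h := sum_symmetricProbeWeight_sq hη hNpos v
    refine (congrArg (fun x => (z : ℝ) ^ 2 * x) h).trans_le ?_
    rw [hc]
    have hv2 : ‖v‖ ^ 2 ≤ 1 := pow_le_one₀ (norm_nonneg v) hv
    show (z : ℝ) ^ 2 * (‖v‖ ^ 2 / (2 * N * η ^ 2)) ≤ z ^ 2 * (1 / (2 * N * η ^ 2))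
    gcongr
  · rw [div_le_iff₀ (by positivity)] at hN
    have e : 9 * τ ^ 2 / (1024 * z ^ 4 * c) = 9 * (N * (2 * η ^ 2 * τ ^ 2)) / (1024 * z ^ 6) := by
      rw [hc]
      field_simp
    rw [e, le_div_iff₀ (by positivity)]
    have hp : (0 : ℝ) < z ^ 6 := by positivity
    -- The requirement is `1024 (5 m + log) ≤ 729 L²`, whereas `L² ≥ 8 m + 2 log`, so `5832 ≥ 5120`
    -- and `1458 ≥ 1024` decide it.
    nlinarith [mul_le_mul_of_nonneg_left hL hp.le, mul_nonneg hp.le hlog,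
      mul_nonneg hp.le (zero_le_one.trans hm')]

end Schemes

end

theorem mainTheorem8 (m : ℕ) (r : PhaseSpace m) (S : QuadMatrix m)
    (hS : S ∈ Matrix.symplecticGroup (Fin m) ℝ)
    (G : ModeSpace m ≃ₗᵢ[ℂ] ModeSpace m) (hG : IsGaussianUnitary r S G)
    (z : ℝ) (hz : ‖S‖ ≤ z) (η : ℝ) (hη : 0 < η)
    (τ : ℝ) (hτ0 : 0 < τ) (hτ1 : τ < 1) (δ : ℝ) (hδ0 : 0 < δ) (hδ1 : δ < 1) :
    (∀ Shat : QuadMatrix m, IsRegularizable Shat →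
      symplecticRegularization Shat ∈ Matrix.symplecticGroup (Fin m) ℝ) ∧
    (∀ N : ℕ,
      (vacuumSharedProtocol m η N).queryCount = (2 * m + 1) * N ∧
      (324 * m * z ^ 6 * (√(2 * m) + √(2 * Real.log (2 * m / δ))) ^ 2 / (η ^ 2 * τ ^ 2) ≤ (N : ℝ) →
        1 - δ ≤ ((vacuumSharedProtocol m η N).outcomeLaw G).real
          ((vacuumSharedProtocol m η N).successEvent S τ))) ∧
    (∀ N : ℕ,
      (symmetricProbeProtocol m η N).queryCount = 4 * m * N ∧
      (81 * z ^ 6 * (2 * √(2 * m) + √(2 * Real.log (1 / δ))) ^ 2 / (2 * η ^ 2 * τ ^ 2) ≤ (N : ℝ) →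
        1 - δ ≤ ((symmetricProbeProtocol m η N).outcomeLaw G).real
          ((symmetricProbeProtocol m η N).successEvent S τ))) := by
  refine ⟨fun Shat h => symplecticRegularization_mem h, fun N =>
    ⟨queryCount_vacuumSharedProtocol η N, fun hN => ?_⟩, fun N =>
    ⟨queryCount_symmetricProbeProtocol η N, fun hN => ?_⟩⟩
  all_goals
    -- Without modes all matrices coincide and success is certain; this case is separate because `1
    -- ≤ z` can be derived only for `m > 0`.
    rcases Nat.eq_zero_or_pos m with rfl | hm
    · have := isProbabilityMeasure_outcomeLaw hS hG
      rw [successEvent_of_isEmpty hS hτ0 hτ1, probReal_univ]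
      linarith
    have : NeZero m := ⟨hm.ne'⟩
    have hz1 : 1 ≤ z := (one_le_norm_of_mem_symplecticGroup hS).trans hz
    lift z to NNReal using zero_le_one.trans hz1
  · exact one_sub_le_successEvent_vacuumShared hS hG hz (by exact_mod_cast hz1) hη hτ0 hτ1 hδ0
      hδ1 hm hN
  · exact one_sub_le_successEvent_symmetricProbe hS hG hz (by exact_mod_cast hz1) hη hτ0 hτ1 hδ0
      hδ1 hm hN
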